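/- There are absolute constants $K>0$ and $C>0$ with the following property. Let $n\ge 1$, let $S_n$ be the group of permutations of $[n]=\{1,\dots,n\}$, and let $\mathbb{E}$ and $\Pr$ be taken with respect to a uniformly random $\pi\in S_n$. For $i,j\in[n]$ let $x_{i,j}\colon S_n\to\{0,1\}$ be the indicator of $\pi(i)=j$. Let $f\colon S_n\to\{0,1\}$, and let $\epsilon\ge 0$ and $\delta>0$ be real numbers such that 1. $f$ is $\epsilon$-close to linear in $L_2$, that is, there is a function of the form $\ell=\sum_{i=1}^n\sum_{j=1}^n c_{i,j}x_{i,j}$ with $c_{i,j}\in\mathbb{R}$ such that $\mathbb{E}[(f-\ell)^2]\le\epsilon$; and 2. $\delta\le\mathbb{E}[f]\le 1-\delta$ and $\delta\ge K\sqrt{\epsilon}$. Then there is a dictator $g\colon S_n\to\{0,1\}$, that is, a $\{0,1\}$-valued function such that either $g(\pi)$ depends only on $\pi(i)$ for some fixed $i\in[n]$, or $g(\pi)$ depends only on $\pi^{-1}(j)$ for some fixed $j\in[n]$, with $$\Pr[f\ne g]\le C\,\frac{\epsilon}{\delta}.$$ -/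

import Mathlib

open Finset
open scoped BigOperators

noncomputable section

namespace NearlyLinear

/-- The symmetric group `S_n`, as the permutations of an `n`-element set. -/
abbrev S (n : ℕ) : Type := Equiv.Perm (Fin n)

/-- Expectation of a real function over a uniformly random permutation. -/
def expectation {n : ℕ} (f : S n → ℝ) : ℝ :=
  (∑ π : S n, f π) / (Fintype.card (S n) : ℝ)

open Classical in
/-- Probability of an event over a uniformly random permutation. -/
def prob {n : ℕ} (P : S n → Prop) : ℝ :=
  ((univ.filter P).card : ℝ) / (Fintype.card (S n) : ℝ)

/-- The indicator `x_{i,j}` of the permutations sending `i` to `j`. -/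
def x {n : ℕ} (i j : Fin n) : S n → ℝ :=
  fun π => if π i = j then 1 else 0

/-- `f` takes only the values `0` and `1`. -/
def IsBoolean {n : ℕ} (f : S n → ℝ) : Prop :=
  ∀ π, f π = 0 ∨ f π = 1

/-- `f` is a real linear combination of the indicators `x_{i,j}`. -/
def IsLinear {n : ℕ} (f : S n → ℝ) : Prop :=
  ∃ c : Fin n → Fin n → ℝ, ∀ π, f π = ∑ i, ∑ j, c i j * x i j π

/-- `f` is `ε`-close to linear in `L₂`: the squared `L₂` distance to some linear function is
at most `ε`. -/
def CloseToLinear {n : ℕ} (ε : ℝ) (f : S n → ℝ) : Prop :=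
  ∃ g : S n → ℝ, IsLinear g ∧ expectation (fun π => (f π - g π) ^ 2) ≤ ε

/-- A dictator is a Boolean function such that the value at `π` depends only on `π(i)` for some
fixed `i`, or only on `π⁻¹(j)` for some fixed `j`. -/
def IsDictator {n : ℕ} (g : S n → ℝ) : Prop :=
  IsBoolean g ∧
    ((∃ (i : Fin n) (φ : Fin n → ℝ), ∀ π, g π = φ (π i)) ∨
      (∃ (j : Fin n) (φ : Fin n → ℝ), ∀ π, g π = φ (π⁻¹ j)))

end NearlyLinear

end

set_option linter.unusedSectionVars false

namespace NearlyLinear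

/-! Choose `m` disjoint pairs of positions and random permutations `ρ`, `σ`. The permutations `σ *
pairSwap e y * ρ⁻¹` form a random Boolean cube inside `S n` whose points are individually uniform.
On it a linear function is a constant plus a Rademacher sum, with coefficients half the second
differences `M i j + M k l - M i l - M k j` of its matrix. As `f` is Boolean, this sum is on average
close to `±1/2`, and a Friedgut–Kalai–Naor argument on the cube (`exists_sum_erase_sq_le`) makes all
coefficients but one small, the remaining one being near `±1/2` (`exists_cube_defect`).

Averaging over cubes shows that second differences are nearly integers. Normalising at a good base
cell and rounding costs only a variance of order `ε`, so `f` is close to a constant plus `permSum d`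
with integer `d` (`exists_int_permSum`).

An integer second difference is either zero or at least `1` in size, so two disjoint quadruples
rarely both have nonzero second differences: probability `O(ε / n²)`, by a Bonferroni argument
(`expect_indPair_le`). Shift rows and columns of `d` until its support is smallest. Then every
nonzero entry lies in a positive proportion of the quadruples through it with nonzero second
difference, so only `O(ε n²)` pairs of nonzero entries avoid sharing a row or column
(`MinSupport.conflictFree_le`). The mean of `f` forces at least `δ n / 2` nonzero entries, hence all
but `O(ε n / δ)` of them lie on one line (`exists_line_of_conflictFree_le`). Deleting the exceptions
leaves a dictator and costs probability `O(ε / δ)`.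

For `n < 1000` the constant `K` is large enough that `f` is exactly integer linear, and integral
linear programming duality shows it is a dictator (`isDictator_of_eq_permSum`). -/

/-- The sign `±1` attached to a bit. -/
noncomputable def sgn (β : Bool) : ℝ := if β then -1 else 1

lemma sgn_not (β : Bool) : sgn (!β) = -sgn β := by cases β <;> simp [sgn]

lemma sgn_sq (β : Bool) : sgn β ^ 2 = 1 := by cases β <;> simp [sgn]

/-! ### The Friedgut–Kalai–Naor theorem for Rademacher sums on the cube. -/

section Cube

variable {ι : Type*} [Fintype ι] [DecidableEq ι]

/-- Flip the bits in a set of coordinates. -/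
def flip (A : Finset ι) (y : ι → Bool) : ι → Bool := fun i => if i ∈ A then !(y i) else y i

lemma flip_flip (A : Finset ι) (y : ι → Bool) : flip A (flip A y) = y := by
  funext i
  by_cases h : i ∈ A <;> simp [flip, h]

lemma expect_flip (A : Finset ι) (φ : (ι → Bool) → ℝ) :
    𝔼 y, φ (flip A y) = 𝔼 y, φ y :=
  Fintype.expect_equiv (Function.Involutive.toPerm (flip A) (flip_flip A)) _ _ (fun _ => rfl)

/-- The Rademacher sum with coefficients `b` over the coordinates in `s`. -/
noncomputable def rad (b : ι → ℝ) (s : Finset ι) (y : ι → Bool) : ℝ := ∑ i ∈ s, b i * sgn (y i)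

lemma rad_flip_of_disjoint (b : ι → ℝ) {s A : Finset ι} (h : Disjoint s A) (y : ι → Bool) :
    rad b s (flip A y) = rad b s y := by
  refine sum_congr rfl fun i hi => ?_
  simp [flip, Finset.disjoint_left.mp h hi]

lemma rad_flip_of_subset (b : ι → ℝ) {s A : Finset ι} (h : s ⊆ A) (y : ι → Bool) :
    rad b s (flip A y) = -rad b s y := by
  rw [rad, rad, ← sum_neg_distrib]
  refine sum_congr rfl fun i hi => ?_
  simp [flip, h hi, sgn_not]

lemma expect_mul_sgn (φ : (ι → Bool) → ℝ) (i : ι) (h : ∀ y, φ (flip {i} y) = φ y) :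
    𝔼 y, φ y * sgn (y i) = 0 := by
  have h1 := expect_flip {i} (fun y => φ y * sgn (y i))
  have h2 : ∀ y : ι → Bool, φ (flip {i} y) * sgn (flip {i} y i) = -(φ y * sgn (y i)) := by
    intro y
    rw [h y]
    simp [flip, sgn_not]
  simp only [h2, expect_neg_distrib] at h1
  linarith

lemma rad_insert (b : ι → ℝ) {s : Finset ι} {i : ι} (hi : i ∉ s) (y : ι → Bool) :
    rad b (insert i s) y = b i * sgn (y i) + rad b s y := by
  rw [rad, sum_insert hi, rad]

lemma expect_mul_rad_sq (b : ι → ℝ) (s : Finset ι) (φ : (ι → Bool) → ℝ)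
    (h : ∀ i ∈ s, ∀ y, φ (flip {i} y) = φ y) :
    𝔼 y, φ y * rad b s y ^ 2 = (∑ i ∈ s, b i ^ 2) * 𝔼 y, φ y := by
  induction s using Finset.induction_on with
  | empty => simp [rad]
  | insert i s hi ih =>
    have ih := ih fun j hj => h j (mem_insert_of_mem hj)
    have hz := expect_mul_sgn (fun y => φ y * rad b s y) i (by
      intro y
      rw [h i (mem_insert_self _ _), rad_flip_of_disjoint]
      simpa using hi)
    have : ∀ y, φ y * rad b (insert i s) y ^ 2
        = b i ^ 2 * φ y + 2 * b i * (φ y * rad b s y * sgn (y i)) + φ y * rad b s y ^ 2 := by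
      intro y
      rw [rad_insert b hi]
      linear_combination (φ y * b i ^ 2) * sgn_sq (y i)
    simp only [this, expect_add_distrib, ← mul_expect, ih, hz, sum_insert hi]
    ring

lemma expect_rad_sq (b : ι → ℝ) (s : Finset ι) :
    𝔼 y, rad b s y ^ 2 = ∑ i ∈ s, b i ^ 2 := by
  simpa using expect_mul_rad_sq b s (fun _ => 1) (by simp)

lemma expect_rad_pow_four_le (b : ι → ℝ) (s : Finset ι) :
    𝔼 y, rad b s y ^ 4 ≤ 3 * (∑ i ∈ s, b i ^ 2) ^ 2 := by
  induction s using Finset.induction_on with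
  | empty => simp [rad]
  | insert i s hi ih =>
    have hinv : ∀ y, rad b s (flip {i} y) = rad b s y := fun y =>
      rad_flip_of_disjoint b (by simpa using hi) y
    have hz1 := expect_mul_sgn (fun y => rad b s y) i hinv
    have hz3 := expect_mul_sgn (fun y => rad b s y ^ 3) i (fun y => by simp only [hinv])
    have : ∀ y, rad b (insert i s) y ^ 4
        = b i ^ 4 + 4 * b i ^ 3 * (rad b s y * sgn (y i)) + 6 * b i ^ 2 * rad b s y ^ 2
          + 4 * b i * (rad b s y ^ 3 * sgn (y i)) + rad b s y ^ 4 := by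
      intro y
      rw [rad_insert b hi]
      linear_combination (b i ^ 4 * (sgn (y i) ^ 2 + 1) + 4 * b i ^ 3 * rad b s y * sgn (y i)
        + 6 * b i ^ 2 * rad b s y ^ 2) * sgn_sq (y i)
    simp only [this, expect_add_distrib, ← mul_expect, hz1, hz3, expect_rad_sq, sum_insert hi,
      Fintype.expect_const]
    nlinarith [sq_nonneg (b i ^ 2)]

/-- Expanding `u * (1 - r * v) ^ 2 ≥ 0`, and its mirror image, bounds the minimum below by a
polynomial, whose expectation needs only second and fourth moments. -/
lemma two_mul_sub_le_min {u v : ℝ} (hu : 0 ≤ u) (hv : 0 ≤ v) (r : ℝ) :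
    2 * r * (u * v) - r ^ 2 * (u ^ 2 * v + u * v ^ 2) ≤ min u v := by
  refine le_min ?_ ?_
  · nlinarith [mul_nonneg hu (sq_nonneg (1 - r * v)), mul_nonneg (mul_nonneg hu hu) hv,
      mul_nonneg (mul_nonneg (mul_nonneg hu hu) hv) (sq_nonneg r)]
  · nlinarith [mul_nonneg hv (sq_nonneg (1 - r * u)),
      mul_nonneg (mul_nonneg (mul_nonneg hv hv) hu) (sq_nonneg r)]

lemma four_mul_min_sq (a c : ℝ) : 4 * min (a ^ 2) (c ^ 2) = (|a + c| - |c - a|) ^ 2 := by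
  have h1 : (|a + c| - |c - a|) ^ 2 = (a + c) ^ 2 + (c - a) ^ 2 - 2 * |(c + a) * (c - a)| := by
    rw [abs_mul, sub_sq, sq_abs, sq_abs, add_comm c a]
    ring
  have h2 : (c + a) * (c - a) = c ^ 2 - a ^ 2 := by ring
  rw [h1, h2]
  rcases le_total (a ^ 2) (c ^ 2) with h | h
  · rw [min_eq_left h, abs_of_nonneg (by linarith)]; ring
  · rw [min_eq_right h, abs_of_nonpos (by linarith)]; ring

/-- The squared distance of a Rademacher sum from `±1/2`. -/
noncomputable def defect (b : ι → ℝ) : ℝ := 𝔼 y, (|rad b univ y| - 1 / 2) ^ 2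

lemma defect_nonneg (b : ι → ℝ) : 0 ≤ defect b :=
  expect_nonneg fun _ _ => sq_nonneg _

/-- Flipping the signs in `A` preserves the distribution and turns `X + Y` into `Y - X`. Both
absolute values are near `1/2`, so they are near each other, and the square of their difference is
`4 * min (X ^ 2) (Y ^ 2)`. -/
lemma expect_min_le_defect (b : ι → ℝ) (A : Finset ι) :
    𝔼 y, min (rad b A y ^ 2) (rad b Aᶜ y ^ 2) ≤ defect b := by
  have h1 := expect_flip A (fun y => (|rad b univ y| - 1 / 2) ^ 2)
  have hs : ∀ y, rad b univ y = rad b A y + rad b Aᶜ y := fun y => by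
    rw [rad, rad, rad, sum_add_sum_compl]
  have hf : ∀ y, rad b univ (flip A y) = rad b Aᶜ y - rad b A y := fun y => by
    rw [hs, rad_flip_of_subset b subset_rfl, rad_flip_of_disjoint b disjoint_compl_left]
    ring
  have h2 : ∀ y, min (rad b A y ^ 2) (rad b Aᶜ y ^ 2)
      ≤ (1 / 2) * ((|rad b univ (flip A y)| - 1 / 2) ^ 2) + (1 / 2) * (|rad b univ y| - 1 / 2) ^ 2 := by
    intro y
    have := four_mul_min_sq (rad b A y) (rad b Aᶜ y)
    rw [hf, hs]
    nlinarith [sq_nonneg ((|rad b A y + rad b Aᶜ y| - 1 / 2) + (|rad b Aᶜ y - rad b A y| - 1 / 2))]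
  refine (expect_le_expect fun y _ => h2 y).trans ?_
  rw [expect_add_distrib, ← mul_expect, ← mul_expect, h1, defect]
  linarith

lemma min_sum_le_defect (b : ι → ℝ) (A : Finset ι) :
    min (∑ i ∈ A, b i ^ 2) (∑ i ∈ Aᶜ, b i ^ 2) ≤ 6 * defect b := by
  have hX0 : 0 ≤ ∑ i ∈ A, b i ^ 2 := sum_nonneg fun i _ => sq_nonneg _
  have hY0 : 0 ≤ ∑ i ∈ Aᶜ, b i ^ 2 := sum_nonneg fun i _ => sq_nonneg _
  have hd := defect_nonneg b
  have hXY : 𝔼 y, rad b A y ^ 2 * rad b Aᶜ y ^ 2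
      = (∑ i ∈ Aᶜ, b i ^ 2) * ∑ i ∈ A, b i ^ 2 := by
    rw [expect_mul_rad_sq b Aᶜ (fun y => rad b A y ^ 2), expect_rad_sq]
    intro i hi y
    rw [rad_flip_of_disjoint]
    simpa using hi
  have hX4Y : 𝔼 y, rad b A y ^ 4 * rad b Aᶜ y ^ 2
      ≤ 3 * (∑ i ∈ A, b i ^ 2) ^ 2 * (∑ i ∈ Aᶜ, b i ^ 2) := by
    rw [expect_mul_rad_sq b Aᶜ (fun y => rad b A y ^ 4)]
    · nlinarith [expect_rad_pow_four_le b A]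
    intro i hi y
    rw [rad_flip_of_disjoint]
    simpa using hi
  have hXY4 : 𝔼 y, rad b Aᶜ y ^ 4 * rad b A y ^ 2
      ≤ 3 * (∑ i ∈ Aᶜ, b i ^ 2) ^ 2 * (∑ i ∈ A, b i ^ 2) := by
    rw [expect_mul_rad_sq b A (fun y => rad b Aᶜ y ^ 4)]
    · nlinarith [expect_rad_pow_four_le b Aᶜ]
    intro i hi y
    rw [rad_flip_of_disjoint]
    simpa using hi
  have hmin := expect_min_le_defect b A
  set P := ∑ i ∈ A, b i ^ 2
  set Q := ∑ i ∈ Aᶜ, b i ^ 2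
  rcases hX0.eq_or_lt with h0 | hP
  · exact (min_le_left _ _).trans (by linarith)
  rcases hY0.eq_or_lt with h0 | hQ
  · exact (min_le_right _ _).trans (by linarith)
  set R := min P Q
  have hR : 0 < R := lt_min hP hQ
  have key : ∀ y, R * (1 / 3 * (P⁻¹ * Q⁻¹ * (rad b A y ^ 2 * rad b Aᶜ y ^ 2))
      - 1 / 36 * (P⁻¹ ^ 2 * Q⁻¹ * (rad b A y ^ 4 * rad b Aᶜ y ^ 2)
        + Q⁻¹ ^ 2 * P⁻¹ * (rad b Aᶜ y ^ 4 * rad b A y ^ 2)))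
      ≤ min (rad b A y ^ 2) (rad b Aᶜ y ^ 2) := by
    intro y
    -- After normalisation the mixed moment is `1` and the two higher ones are at most `3`, so the
    -- lower bound is `2r - 6r²`. It is largest at `r = 1/6`, with value `1/6`: the source of the
    -- factor `6`.
    have h := two_mul_sub_le_min (u := P⁻¹ * rad b A y ^ 2) (v := Q⁻¹ * rad b Aᶜ y ^ 2)
      (by positivity) (by positivity) (1 / 6)
    have h' := mul_le_mul_of_nonneg_left h hR.le
    refine le_trans (le_of_eq ?_) (h'.trans (le_min ?_ ?_))
    · ring
    · refine (mul_le_mul_of_nonneg_left (min_le_left _ _) hR.le).trans ?_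
      have : R * P⁻¹ ≤ 1 := by
        rw [← div_eq_mul_inv, div_le_one hP]; exact min_le_left _ _
      nlinarith [sq_nonneg (rad b A y)]
    · refine (mul_le_mul_of_nonneg_left (min_le_right _ _) hR.le).trans ?_
      have : R * Q⁻¹ ≤ 1 := by
        rw [← div_eq_mul_inv, div_le_one hQ]; exact min_le_right _ _
      nlinarith [sq_nonneg (rad b Aᶜ y)]
  have h := (expect_le_expect (s := univ) fun y _ => key y).trans hmin
  rw [← mul_expect, expect_sub_distrib, ← mul_expect, ← mul_expect, ← mul_expect,
    expect_add_distrib, ← mul_expect, ← mul_expect, hXY] at h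
  have e1 : P⁻¹ * Q⁻¹ * (Q * P) = 1 := by field_simp
  have e2 : P⁻¹ ^ 2 * Q⁻¹ * (𝔼 y, rad b A y ^ 4 * rad b Aᶜ y ^ 2) ≤ 3 := by
    refine (mul_le_mul_of_nonneg_left hX4Y (by positivity)).trans (le_of_eq ?_)
    field_simp
  have e3 : Q⁻¹ ^ 2 * P⁻¹ * (𝔼 y, rad b Aᶜ y ^ 4 * rad b A y ^ 2) ≤ 3 := by
    refine (mul_le_mul_of_nonneg_left hXY4 (by positivity)).trans (le_of_eq ?_)
    field_simp
  rw [e1] at h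
  nlinarith

/-- The Friedgut–Kalai–Naor theorem on the cube: if a Rademacher sum is nearly `±1/2` then all
but one of its coefficients are small. -/
theorem exists_sum_erase_sq_le [Nonempty ι] (b : ι → ℝ) :
    ∃ k, ∑ i ∈ univ.erase k, b i ^ 2 ≤ 18 * defect b := by
  by_contra! hcon
  have hd := defect_nonneg b
  have hT : ∀ k, ∑ i, b i ^ 2 = b k ^ 2 + ∑ i ∈ univ.erase k, b i ^ 2 := fun k =>
    (add_sum_erase _ _ (mem_univ k)).symm
  have hsmall : ∀ k, b k ^ 2 ≤ 6 * defect b := by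
    intro k
    have h := min_sum_le_defect b {k}
    rw [sum_singleton, compl_singleton, min_le_iff] at h
    rcases h with h | h
    · exact h
    · linarith [hcon k]
  -- Partial sums cannot cross the gap: one more term keeps the sum at most `12 * defect b`, while
  -- the total exceeds `18 * defect b`. The complement is then too large to be the small side, so
  -- the partial sum is again at most `6 * defect b`.
  have hall : ∀ s : Finset ι, ∑ i ∈ s, b i ^ 2 ≤ 6 * defect b := by
    intro s
    induction s using Finset.induction_on with
    | empty => simpa using hd
    | insert i s hi ih =>
      have h := min_sum_le_defect b (insert i s)
      rw [min_le_iff] at h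
      rcases h with h | h
      · exact h
      · have h1 := sum_add_sum_compl (insert i s) fun i => b i ^ 2
        rw [sum_insert hi] at h1
        have := hT i
        have := hcon i
        have := hsmall i
        nlinarith [sq_nonneg (b i)]
  obtain ⟨k⟩ := ‹Nonempty ι›
  linarith [hT k, hcon k, hall univ, sq_nonneg (b k)]

lemma sum_sq_le_defect (b : ι → ℝ) : ∑ i, b i ^ 2 ≤ 1 / 2 + 2 * defect b := by
  rw [← expect_rad_sq]
  have : ∀ y, rad b univ y ^ 2 ≤ 1 / 2 + 2 * (|rad b univ y| - 1 / 2) ^ 2 := by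
    intro y
    nlinarith [sq_abs (rad b univ y), sq_nonneg (|rad b univ y| - 1)]
  refine (expect_le_expect fun y _ => this y).trans (le_of_eq ?_)
  rw [expect_add_distrib, ← mul_expect, Fintype.expect_const, defect]

lemma sq_abs_sub_half_le (b : ι → ℝ) (k : ι) :
    (|b k| - 1 / 2) ^ 2 ≤ 2 * (∑ i ∈ univ.erase k, b i ^ 2) + 2 * defect b := by
  have hpt : ∀ y, (|b k| - 1 / 2) ^ 2
      ≤ 2 * rad b (univ.erase k) y ^ 2 + 2 * (|rad b univ y| - 1 / 2) ^ 2 := by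
    intro y
    have h0 : rad b univ y = b k * sgn (y k) + rad b (univ.erase k) y := by
      rw [rad, rad, add_sum_erase _ (fun i => b i * sgn (y i)) (mem_univ k)]
    have h1 : |b k| = |b k * sgn (y k)| := by
      cases y k <;> simp [sgn]
    have h2 : (|b k| - |rad b univ y|) ^ 2 ≤ rad b (univ.erase k) y ^ 2 := by
      rw [sq_le_sq, h1]
      refine (abs_abs_sub_abs_le _ _).trans (le_of_eq ?_)
      rw [h0, ← abs_neg]
      congr 1
      ring
    nlinarith [sq_nonneg ((|b k| - |rad b univ y|) - (|rad b univ y| - 1 / 2))]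
  have h := expect_le_expect (s := univ) fun y _ => hpt y
  rw [Fintype.expect_const, expect_add_distrib, ← mul_expect, ← mul_expect, expect_rad_sq] at h
  exact h

/-- If a Rademacher sum is nearly `±1/2` then twice its coefficients are nearly integers. -/
theorem sum_sq_sub_round_le [Nonempty ι] (b : ι → ℝ) :
    ∑ i, (2 * b i - round (2 * b i)) ^ 2 ≤ 224 * defect b := by
  obtain ⟨k, hk⟩ := exists_sum_erase_sq_le b
  have hround : ∀ (u : ℝ) (z : ℤ), (u - round u) ^ 2 ≤ (u - z) ^ 2 := fun u z =>
    sq_le_sq.mpr (round_le u z)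
  rw [← add_sum_erase _ _ (mem_univ k)]
  have h1 : ∑ i ∈ univ.erase k, (2 * b i - round (2 * b i)) ^ 2
      ≤ 4 * ∑ i ∈ univ.erase k, b i ^ 2 := by
    rw [mul_sum]
    refine sum_le_sum fun i _ => (hround _ 0).trans (le_of_eq ?_)
    push_cast
    ring
  have h2 := sq_abs_sub_half_le b k
  have h3 : (2 * b k - round (2 * b k)) ^ 2 ≤ 4 * (|b k| - 1 / 2) ^ 2 := by
    rcases abs_cases (b k) with ⟨h, _⟩ | ⟨h, _⟩
    · refine (hround _ 1).trans (le_of_eq ?_)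
      rw [h]; push_cast; ring
    · refine (hround _ (-1)).trans (le_of_eq ?_)
      rw [h]; push_cast; ring
  -- The constant is `4 * 18` for the small coefficients plus `4 * (2 * 18 + 2)` for the exceptional
  -- one.
  linarith

end Cube

end NearlyLinear

namespace NearlyLinear

/-! ### Averages over permutations of functions of finitely many values. -/

section Symmetry

variable {α κ : Type*} [Fintype α] [DecidableEq α]

lemma exists_perm_comp_eq {p q : κ → α} (hp : p.Injective) (hq : q.Injective) :
    ∃ τ : Equiv.Perm α, ∀ k, τ (p k) = q k := by
  classical
  let e : {x // x ∈ Set.range p} ≃ {x // x ∈ Set.range q} :=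
    (Equiv.ofInjective p hp).symm.trans (Equiv.ofInjective q hq)
  refine ⟨e.extendSubtype, fun k => ?_⟩
  rw [Equiv.extendSubtype_apply_of_mem e (p k) ⟨k, rfl⟩]
  have : (Equiv.ofInjective p hp).symm ⟨p k, ⟨k, rfl⟩⟩ = k := Equiv.ofInjective_symm_apply hp k
  simp [e, this]

lemma expect_comp_perm_eq {p q : κ → α} (hp : p.Injective) (hq : q.Injective)
    (ψ : (κ → α) → ℝ) :
    𝔼 ρ : Equiv.Perm α, ψ (fun k => ρ (p k)) = 𝔼 ρ : Equiv.Perm α, ψ (fun k => ρ (q k)) := by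
  obtain ⟨τ, hτ⟩ := exists_perm_comp_eq hp hq
  symm
  refine Fintype.expect_equiv (Equiv.mulRight τ) _ _ fun ρ => ?_
  simp [hτ]

lemma expect_comp_perm_eq₂ {p q p' q' : κ → α} (hp : p.Injective) (hq : q.Injective)
    (hp' : p'.Injective) (hq' : q'.Injective) (ψ : (κ → α) → (κ → α) → ℝ) :
    𝔼 ρ : Equiv.Perm α, 𝔼 σ : Equiv.Perm α, ψ (fun k => ρ (p k)) (fun k => σ (p' k))
      = 𝔼 ρ : Equiv.Perm α, 𝔼 σ : Equiv.Perm α, ψ (fun k => ρ (q k)) (fun k => σ (q' k)) := by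
  have h1 : ∀ ρ : Equiv.Perm α, 𝔼 σ : Equiv.Perm α, ψ (fun k => ρ (p k)) (fun k => σ (p' k))
      = 𝔼 σ : Equiv.Perm α, ψ (fun k => ρ (p k)) (fun k => σ (q' k)) := fun ρ =>
    expect_comp_perm_eq hp' hq' (ψ fun k => ρ (p k))
  simp only [h1]
  exact expect_comp_perm_eq hp hq
    fun a => 𝔼 σ : Equiv.Perm α, ψ a (fun k => σ (q' k))

/-- Relabelling by `ρ` and `σ` leaves the total unchanged, so average over them. Each pair of
injective tuples then contributes the same average, the others contribute zero, and the count of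
injective tuples is bounded by that of all tuples. -/
lemma sum_injective_le [Fintype κ] [DecidableEq κ] {p : κ → α} (hp : p.Injective)
    (ψ : (κ → α) → (κ → α) → ℝ) (hψ : ∀ a b, 0 ≤ ψ a b)
    (hl : ∀ a b, ¬ a.Injective → ψ a b = 0) (hr : ∀ a b, ¬ b.Injective → ψ a b = 0) :
    ∑ a, ∑ b, ψ a b ≤ ((Fintype.card α : ℝ) ^ Fintype.card κ) ^ 2
      * 𝔼 ρ : Equiv.Perm α, 𝔼 σ : Equiv.Perm α, ψ (fun k => ρ (p k)) (fun k => σ (p k)) := by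
  set W := 𝔼 ρ : Equiv.Perm α, 𝔼 σ : Equiv.Perm α, ψ (fun k => ρ (p k)) (fun k => σ (p k))
    with hW
  have hW0 : 0 ≤ W := expect_nonneg fun _ _ => expect_nonneg fun _ _ => hψ _ _
  have hre : ∀ ρ σ : Equiv.Perm α,
      ∑ a : κ → α, ∑ b : κ → α, ψ (fun k => ρ (a k)) (fun k => σ (b k)) = ∑ a, ∑ b, ψ a b := by
    intro ρ σ
    refine Fintype.sum_equiv (Equiv.arrowCongr (Equiv.refl κ) ρ) _ _ fun a => ?_
    refine Fintype.sum_equiv (Equiv.arrowCongr (Equiv.refl κ) σ) _ _ fun b => ?_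
    rfl
  have h1 : ∑ a, ∑ b, ψ a b = ∑ a : κ → α, ∑ b : κ → α,
      𝔼 ρ : Equiv.Perm α, 𝔼 σ : Equiv.Perm α, ψ (fun k => ρ (a k)) (fun k => σ (b k)) := by
    simp only [← expect_sum_comm, hre, Fintype.expect_const]
  have h2 : ∀ a b : κ → α,
      𝔼 ρ : Equiv.Perm α, 𝔼 σ : Equiv.Perm α, ψ (fun k => ρ (a k)) (fun k => σ (b k)) ≤ W := by
    intro a b
    by_cases ha : a.Injective
    · by_cases hb : b.Injective
      · exact (expect_comp_perm_eq₂ ha hp hb hp ψ).le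
      · refine le_trans (le_of_eq ?_) hW0
        refine expect_eq_zero fun ρ _ => expect_eq_zero fun σ _ => hr _ _ fun h => hb ?_
        exact h.of_comp (f := σ)
    · refine le_trans (le_of_eq ?_) hW0
      refine expect_eq_zero fun ρ _ => expect_eq_zero fun σ _ => hl _ _ fun h => ha ?_
      exact h.of_comp (f := ρ)
  rw [h1]
  refine (sum_le_sum fun a _ => sum_le_sum fun b _ => h2 a b).trans (le_of_eq ?_)
  simp only [sum_const, card_univ, Fintype.card_fun, nsmul_eq_mul]
  push_cast
  ring

end Symmetry

/-! ### Random Boolean cubes inside the symmetric group. -/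

section Embedding

variable {n m : ℕ}

/-- The value at `π` of the linear function with coefficient matrix `M`. -/
def permSum {R : Type*} [AddCommMonoid R] (M : Fin n → Fin n → R) (π : S n) : R := ∑ i, M i (π i)

/-- The change of `permSum M` under a transposition. -/
def secDiff {R : Type*} [AddCommGroup R] (M : Fin n → Fin n → R) (i k j l : Fin n) : R :=
  M i j + M k l - M i l - M k j

/-- The permutation which swaps the two points of each marked pair. -/
def pairFlip (y : Fin m → Bool) : Equiv.Perm (Fin m × Bool) :=
  Function.Involutive.toPerm (fun a => (a.1, Bool.xor a.2 (y a.1))) (by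
    rintro ⟨t, β⟩
    simp)

/-- The product of the transpositions `(e (t, false)  e (t, true))` over the marked `t`. -/
def pairSwap (e : Fin m × Bool ↪ Fin n) (y : Fin m → Bool) : S n :=
  (pairFlip y).viaFintypeEmbedding e

/-- The second difference of `M` on the rows and columns of the pair number `t`. -/
def pairDiff {R : Type*} [AddCommGroup R] (M : Fin n → Fin n → R) (e : Fin m × Bool ↪ Fin n)
    (ρ σ : S n) (t : Fin m) : R :=
  secDiff M (ρ (e (t, false))) (ρ (e (t, true))) (σ (e (t, false))) (σ (e (t, true)))

/-- Swapping a pair exchanges the two diagonals of a 2×2 minor, so each pair contributes the mean of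
the diagonal sums plus or minus half their difference. -/
lemma exists_permSum_pairSwap (M : Fin n → Fin n → ℝ) (e : Fin m × Bool ↪ Fin n) (ρ σ : S n) :
    ∃ A : ℝ, ∀ y, permSum M (σ * pairSwap e y * ρ⁻¹)
      = A + ∑ t, pairDiff M e ρ σ t / 2 * sgn (y t) := by
  refine ⟨∑ k ∈ (univ.map e)ᶜ, M (ρ k) (σ k) + ∑ t : Fin m,
    (M (ρ (e (t, false))) (σ (e (t, false))) + M (ρ (e (t, true))) (σ (e (t, true)))
      + M (ρ (e (t, false))) (σ (e (t, true))) + M (ρ (e (t, true))) (σ (e (t, false)))) / 2,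
    fun y => ?_⟩
  have h1 : permSum M (σ * pairSwap e y * ρ⁻¹) = ∑ k, M (ρ k) (σ (pairSwap e y k)) := by
    rw [permSum]
    refine (Fintype.sum_equiv ρ _ _ fun k => ?_).symm
    simp
  have h2 : ∀ t β, pairSwap e y (e (t, β)) = e (t, Bool.xor β (y t)) := by
    intro t β
    rw [pairSwap, Equiv.Perm.viaFintypeEmbedding_apply_image]
    rfl
  rw [h1, ← sum_compl_add_sum (univ.map e), sum_map, Fintype.sum_prod_type, add_assoc,
    ← sum_add_distrib]
  congr 1
  · refine sum_congr rfl fun k hk => ?_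
    rw [pairSwap, Equiv.Perm.viaFintypeEmbedding_apply_notMem_range]
    simpa using hk
  · refine sum_congr rfl fun t _ => ?_
    rw [Fintype.sum_bool, h2, h2, pairDiff, secDiff]
    cases y t <;> simp [sgn] <;> ring

/-- For fixed `ρ` and `y` the map `σ ↦ σ * pairSwap e y * ρ⁻¹` is a bijection, so every point of the
random cube is uniform. -/
lemma expect_eq_expect_cube (e : Fin m × Bool ↪ Fin n) (φ : S n → ℝ) :
    𝔼 ρ, 𝔼 σ, 𝔼 y, φ (σ * pairSwap e y * ρ⁻¹) = 𝔼 π, φ π := by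
  have h : ∀ (ρ : S n) (y : Fin m → Bool),
      𝔼 σ, φ (σ * pairSwap e y * ρ⁻¹) = 𝔼 π, φ π := fun ρ y =>
    Fintype.expect_equiv ((Equiv.mulRight (pairSwap e y)).trans (Equiv.mulRight ρ⁻¹)) _ _
      fun σ => rfl
  have h' : ∀ ρ : S n, 𝔼 σ, 𝔼 y, φ (σ * pairSwap e y * ρ⁻¹) = 𝔼 π, φ π := by
    intro ρ
    rw [expect_comm]
    simp only [h, Fintype.expect_const]
  simp only [h', Fintype.expect_const]

/-- Fold the sign of the `none` coordinate into all the others. -/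
def foldSign (ι : Type*) : (Option ι → Bool) ≃ Bool × (ι → Bool) where
  toFun z := (z none, fun t => Bool.xor (z none) (z (some t)))
  invFun a := fun o => o.elim a.1 fun t => Bool.xor a.1 (a.2 t)
  left_inv z := by
    funext o
    cases o <;> simp
  right_inv a := by
    ext <;> simp

lemma sgn_xor (β γ : Bool) : sgn (Bool.xor β γ) = sgn β * sgn γ := by
  cases β <;> cases γ <;> simp [sgn]

/-- A constant term becomes one more Rademacher coefficient, because the absolute value ignores a
global sign. -/
lemma defect_option {ι : Type*} [Fintype ι] [DecidableEq ι] (b : Option ι → ℝ) :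
    defect b = 𝔼 y : ι → Bool, (|b none + ∑ t, b (some t) * sgn (y t)| - 1 / 2) ^ 2 := by
  have h : defect b = 𝔼 a : Bool × (ι → Bool),
      (|b none + ∑ t, b (some t) * sgn (a.2 t)| - 1 / 2) ^ 2 := by
    refine Fintype.expect_equiv (foldSign ι) _ _ fun z => ?_
    have : |rad b univ z| = |b none + ∑ t, b (some t) * sgn ((foldSign ι z).2 t)| := by
      rw [rad, Fintype.sum_option]
      simp only [foldSign, Equiv.coe_fn_mk, sgn_xor]
      rw [← one_mul |b none + _|, ← (show |sgn (z none)| = 1 by cases z none <;> simp [sgn]),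
        ← abs_mul, mul_add, mul_sum, mul_comm (sgn _) (b none)]
      congr 2
      refine sum_congr rfl fun t _ => ?_
      linear_combination (-(b (some t) * sgn (z (some t)))) * sgn_sq (z none)
    rw [this]
  rw [h, ← univ_product_univ, expect_product]
  simp

/-- The averaged consequences of the cube theorem for a linear function close to Boolean. -/
theorem exists_cube_defect {f : S n → ℝ} (hf : IsBoolean f) (M : Fin n → Fin n → ℝ) (c ε : ℝ)
    (h : 𝔼 π, (f π - (c + permSum M π)) ^ 2 ≤ ε) (e : Fin m × Bool ↪ Fin n) :
    ∃ η : S n → S n → ℝ, 𝔼 ρ, 𝔼 σ, η ρ σ ≤ ε ∧ ∀ ρ σ,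
      ∑ t, (pairDiff M e ρ σ t - round (pairDiff M e ρ σ t)) ^ 2 ≤ 224 * η ρ σ ∧
      (∀ s t, s ≠ t → min (pairDiff M e ρ σ s ^ 2) (pairDiff M e ρ σ t ^ 2) ≤ 72 * η ρ σ) ∧
      ∑ t, pairDiff M e ρ σ t ^ 2 ≤ 2 + 8 * η ρ σ := by
  choose A hA using exists_permSum_pairSwap M e
  -- Subtracting `1/2` moves the Boolean values to `±1/2`.
  let b : S n → S n → Option (Fin m) → ℝ := fun ρ σ o =>
    o.elim (c + A ρ σ - 1 / 2) fun t => pairDiff M e ρ σ t / 2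
  have hb : ∀ ρ σ t, 2 * b ρ σ (some t) = pairDiff M e ρ σ t := fun ρ σ t =>
    mul_div_cancel₀ _ two_ne_zero
  refine ⟨fun ρ σ => defect (b ρ σ), ?_, fun ρ σ => ⟨?_, ?_, ?_⟩⟩
  · refine le_trans ?_ h
    rw [← expect_eq_expect_cube e fun π => (f π - (c + permSum M π)) ^ 2]
    refine expect_le_expect fun ρ _ => expect_le_expect fun σ _ => ?_
    change defect (b ρ σ) ≤ _
    rw [defect_option]
    refine expect_le_expect fun y _ => ?_
    have h1 : b ρ σ none + ∑ t, b ρ σ (some t) * sgn (y t)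
        = c + permSum M (σ * pairSwap e y * ρ⁻¹) - 1 / 2 := by
      rw [hA]
      simp only [b, Option.elim]
      ring
    rw [h1, sq_le_sq]
    set u := c + permSum M (σ * pairSwap e y * ρ⁻¹)
    rcases hf (σ * pairSwap e y * ρ⁻¹) with h0 | h0 <;> rw [h0]
    · have := abs_abs_sub_abs_le (u - 1 / 2) (-1 / 2)
      rw [show |(-1 / 2 : ℝ)| = 1 / 2 by norm_num [abs_div]] at this
      refine this.trans (le_of_eq ?_)
      rw [← abs_neg]; congr 1; ring
    · have := abs_abs_sub_abs_le (u - 1 / 2) (1 / 2)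
      rw [show |(1 / 2 : ℝ)| = 1 / 2 by norm_num [abs_div]] at this
      refine this.trans (le_of_eq ?_)
      rw [← abs_neg]; congr 1; ring
  · have h1 := sum_sq_sub_round_le (b ρ σ)
    rw [Fintype.sum_option] at h1
    simp only [hb] at h1
    nlinarith [sq_nonneg (2 * b ρ σ none - round (2 * b ρ σ none))]
  · intro s t hst
    obtain ⟨k, hk⟩ := exists_sum_erase_sq_le (b ρ σ)
    have key : ∀ r, some r ≠ k → pairDiff M e ρ σ r ^ 2 ≤ 72 * defect (b ρ σ) := by
      intro r hr
      have := single_le_sum (f := fun o => b ρ σ o ^ 2) (fun o _ => sq_nonneg _)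
        (mem_erase.mpr ⟨hr, mem_univ _⟩)
      rw [← hb]
      linarith [mul_pow 2 (b ρ σ (some r)) 2]
    by_cases hs : some s = k
    · refine (min_le_right _ _).trans (key t ?_)
      rw [← hs]
      simpa using hst.symm
    · exact (min_le_left _ _).trans (key s hs)
  · have h1 := sum_sq_le_defect (b ρ σ)
    rw [Fintype.sum_option] at h1
    have h2 : ∑ t, pairDiff M e ρ σ t ^ 2 = 4 * ∑ t, b ρ σ (some t) ^ 2 := by
      rw [mul_sum]
      refine sum_congr rfl fun t _ => ?_
      rw [← hb]
      ring
    rw [h2]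
    nlinarith [sq_nonneg (b ρ σ none)]

lemma exists_pairs (h : 2 * m ≤ n) : Nonempty (Fin m × Bool ↪ Fin n) := by
  refine Function.Embedding.nonempty_of_card_le ?_
  simp
  omega

/-- The average of a function of a random pair of rows and columns bounds the total. -/
lemma sum_secDiff_le (Φ : ℝ → ℝ) (h0 : Φ 0 = 0) (hΦ : ∀ x, 0 ≤ Φ x) (M : Fin n → Fin n → ℝ)
    (e : Fin m × Bool ↪ Fin n) (t : Fin m) :
    ∑ i, ∑ k, ∑ j, ∑ l, Φ (secDiff M i k j l)
      ≤ (n : ℝ) ^ 4 * 𝔼 ρ, 𝔼 σ, Φ (pairDiff M e ρ σ t) := by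
  have h := sum_injective_le (κ := Bool) (p := fun β => e (t, β))
    (fun a b hab => by simpa using hab)
    (fun a b : Bool → Fin n => Φ (secDiff M (a false) (a true) (b false) (b true)))
    (fun a b => hΦ _) ?_ ?_
  · rw [Fintype.card_fin, Fintype.card_bool, ← pow_mul] at h
    refine le_trans (le_of_eq ?_) h
    have hb : ∀ F : Fin n → Fin n → ℝ,
        ∑ a : Bool → Fin n, F (a false) (a true) = ∑ i, ∑ k, F i k := by
      intro F
      rw [← Fintype.sum_prod_type']
      exact Fintype.sum_equiv ((Equiv.boolArrowEquivProd (Fin n))) _ _ fun a => rfl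
    rw [← hb fun i k => ∑ j, ∑ l, Φ (secDiff M i k j l)]
    exact sum_congr rfl fun a _ => (hb fun j l => Φ (secDiff M (a false) (a true) j l)).symm
  · intro a b ha
    have : a false = a true := by
      by_contra hne
      refine ha fun β γ hβγ => ?_
      cases β <;> cases γ <;> simp_all
    simp only [secDiff, this]
    rw [← h0]
    congr 1
    ring
  · intro a b hb
    have : b false = b true := by
      by_contra hne
      refine hb fun β γ hβγ => ?_
      cases β <;> cases γ <;> simp_all
    simp only [secDiff, this]
    rw [← h0]
    congr 1
    ring

end Embedding

end NearlyLinear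

/-! ### Variance of linear functions and rounding to integer coefficients. -/

namespace NearlyLinear

variable {n m : ℕ}

lemma card_mul_expect_apply (i : Fin n) (φ : Fin n → ℝ) :
    (n : ℝ) * 𝔼 π : S n, φ (π i) = ∑ j, φ j := by
  have h1 : ∀ k, 𝔼 π : S n, φ (π k) = 𝔼 π : S n, φ (π i) := fun k =>
    expect_comp_perm_eq (κ := Unit) (p := fun _ => k) (q := fun _ => i)
      (Function.injective_of_subsingleton _) (Function.injective_of_subsingleton _)
      fun a => φ (a ())
  have h2 : ∑ k, 𝔼 π : S n, φ (π k) = ∑ j, φ j := by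
    rw [← expect_sum_comm]
    simp only [Equiv.sum_comp, Fintype.expect_const]
  rw [← h2]
  simp [h1]

/-- By symmetry the expectation is the same for every position other than `i`. Summing over those
positions replaces `ψ (π k)` by `-ψ (π i)`, since `ψ` has total zero. -/
lemma card_mul_expect_mul_apply {i k : Fin n} (hik : i ≠ k) (φ ψ : Fin n → ℝ)
    (hψ : ∑ j, ψ j = 0) :
    ((n : ℝ) * (n - 1)) * 𝔼 π : S n, φ (π i) * ψ (π k) = -∑ j, φ j * ψ j := by
  have h1 : ∀ l ∈ univ.erase i,
      𝔼 π : S n, φ (π i) * ψ (π l) = 𝔼 π : S n, φ (π i) * ψ (π k) := by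
    intro l hl
    refine expect_comp_perm_eq (κ := Bool) (p := fun β => if β then i else l)
      (q := fun β => if β then i else k) ?_ ?_ fun a => φ (a true) * ψ (a false)
    · intro β γ; have := (mem_erase.mp hl).1; cases β <;> cases γ <;> simp [this, this.symm]
    · intro β γ; cases β <;> cases γ <;> simp [hik, hik.symm]
  have h2 : ∑ l ∈ univ.erase i, 𝔼 π : S n, φ (π i) * ψ (π l)
      = -𝔼 π : S n, φ (π i) * ψ (π i) := by
    rw [← expect_sum_comm, ← expect_neg_distrib]
    refine expect_congr rfl fun π _ => ?_
    rw [← mul_sum]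
    have : ∑ l ∈ univ.erase i, ψ (π l) = -ψ (π i) := by
      have := add_sum_erase univ (fun l => ψ (π l)) (mem_univ i)
      rw [Equiv.sum_comp π ψ, hψ] at this
      linarith
    rw [this]
    ring
  rw [sum_congr rfl h1, sum_const, card_erase_of_mem (mem_univ i), card_univ, Fintype.card_fin,
    nsmul_eq_mul, Nat.cast_sub (by have := i.2; omega), Nat.cast_one] at h2
  rw [mul_assoc, h2, mul_neg, card_mul_expect_apply i fun j => φ j * ψ j]

/-- The variance of a linear function is controlled by the squares of its coefficients. -/
lemma exists_expect_sq_sub_le (hn : 2 ≤ n) (h : Fin n → Fin n → ℝ) :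
    ∃ μ : ℝ, 𝔼 π, (permSum h π - μ) ^ 2 ≤ (∑ i, ∑ j, h i j ^ 2) / (n - 1) := by
  have hn' : (2 : ℝ) ≤ n := by exact_mod_cast hn
  -- With centred rows, the second moment times `n * (n - 1)` is `n` times the sum of squares minus
  -- the squared column sums. The latter may be dropped.
  let r : Fin n → ℝ := fun i => (∑ j, h i j) / n
  let g : Fin n → Fin n → ℝ := fun i j => h i j - r i
  have hg0 : ∀ i, ∑ j, g i j = 0 := by
    intro i
    simp only [g, r, sum_sub_distrib, sum_const, card_univ, Fintype.card_fin, nsmul_eq_mul]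
    field_simp
    ring
  have hgh : ∑ i, ∑ j, g i j ^ 2 ≤ ∑ i, ∑ j, h i j ^ 2 := by
    refine sum_le_sum fun i _ => ?_
    have h1 : ∑ j, h i j ^ 2 = ∑ j, g i j ^ 2 + (2 * r i) * ∑ j, g i j + n * r i ^ 2 := by
      have : ∑ _j : Fin n, r i ^ 2 = n * r i ^ 2 := by simp
      rw [mul_sum, ← this, ← sum_add_distrib, ← sum_add_distrib]
      refine sum_congr rfl fun j _ => ?_
      simp only [g]
      ring
    rw [h1, hg0]
    nlinarith [sq_nonneg (r i)]
  refine ⟨∑ i, r i, ?_⟩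
  have hsub : ∀ π, permSum h π - ∑ i, r i = permSum g π := fun π => by
    simp only [permSum, g, sum_sub_distrib]
  simp only [hsub]
  rw [le_div_iff₀ (by linarith)]
  refine le_trans ?_ hgh
  have hexp : 𝔼 π, permSum g π ^ 2
      = ∑ i, ∑ k, 𝔼 π : S n, g i (π i) * g k (π k) := by
    simp only [← expect_sum_comm]
    refine expect_congr rfl fun π _ => ?_
    rw [sq, permSum, sum_mul_sum]
  have hterm : ∀ i k, ((n : ℝ) * (n - 1)) * 𝔼 π : S n, g i (π i) * g k (π k)
      = -∑ j, g i j * g k j + if i = k then n * ∑ j, g i j ^ 2 else 0 := by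
    intro i k
    split_ifs with hik
    · subst hik
      have := card_mul_expect_apply i fun j => g i j * g i j
      rw [mul_assoc, mul_left_comm, this]
      simp only [sq]
      ring
    · rw [card_mul_expect_mul_apply hik _ _ (hg0 k), add_zero]
  have hcol : ∑ i, ∑ k, ∑ j, g i j * g k j = ∑ j, (∑ i, g i j) ^ 2 := by
    calc ∑ i, ∑ k, ∑ j, g i j * g k j = ∑ i, ∑ j, ∑ k, g i j * g k j :=
          sum_congr rfl fun i _ => sum_comm
      _ = ∑ j, ∑ i, ∑ k, g i j * g k j := sum_comm
      _ = ∑ j, (∑ i, g i j) ^ 2 := sum_congr rfl fun j _ => by rw [sq, sum_mul_sum]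
  have hmul : ((n : ℝ) * (n - 1)) * 𝔼 π, permSum g π ^ 2
      = -∑ j, (∑ i, g i j) ^ 2 + n * ∑ i, ∑ j, g i j ^ 2 := by
    rw [hexp, mul_sum]
    rw [sum_congr rfl fun i _ => mul_sum univ _ ((n : ℝ) * (n - 1))]
    simp only [hterm, sum_add_distrib, sum_neg_distrib, sum_ite_eq, mem_univ, if_true]
    rw [hcol, ← mul_sum]
  have hpos : 0 ≤ ∑ j, (∑ i, g i j) ^ 2 := sum_nonneg fun _ _ => sq_nonneg _
  have : (n : ℝ) * ((𝔼 π, permSum g π ^ 2) * (n - 1)) ≤ n * ∑ i, ∑ j, g i j ^ 2 := by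
    linarith [hmul]
  exact le_of_mul_le_mul_left this (by linarith)

/-- Normalising the coefficients at a base cell changes a linear function by a constant. -/
lemma permSum_eq_secDiff_add (M : Fin n → Fin n → ℝ) (k l : Fin n) :
    ∃ c : ℝ, ∀ π, permSum M π = c + permSum (fun i j => secDiff M i k j l) π := by
  refine ⟨∑ i, M i l + ∑ j, M k j - ∑ _i : Fin n, M k l, fun π => ?_⟩
  have h1 : ∑ j, M k j = ∑ i, M k (π i) := (Equiv.sum_comp π _).symm
  rw [h1, permSum, permSum, ← sum_add_distrib, ← sum_sub_distrib, ← sum_add_distrib]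
  refine sum_congr rfl fun i _ => ?_
  rw [secDiff]
  ring

lemma sum_secDiff_le_of_expect_le (Φ : ℝ → ℝ) (h0 : Φ 0 = 0) (hΦ : ∀ x, 0 ≤ Φ x)
    (M : Fin n → Fin n → ℝ) (e : Fin m × Bool ↪ Fin n) (hm : 0 < m) (hmn : n ≤ 3 * m) {β : ℝ}
    (h : 𝔼 ρ, 𝔼 σ, ∑ t, Φ (pairDiff M e ρ σ t) ≤ β) :
    ∑ i, ∑ k, ∑ j, ∑ l, Φ (secDiff M i k j l) ≤ 3 * β * n ^ 3 := by
  have h1 : (m : ℝ) * ∑ i, ∑ k, ∑ j, ∑ l, Φ (secDiff M i k j l) ≤ n ^ 4 * β := by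
    have h2 : ∑ _t : Fin m, ∑ i, ∑ k, ∑ j, ∑ l, Φ (secDiff M i k j l)
        ≤ ∑ t, (n : ℝ) ^ 4 * 𝔼 ρ, 𝔼 σ, Φ (pairDiff M e ρ σ t) :=
      sum_le_sum fun t _ => sum_secDiff_le Φ h0 hΦ M e t
    rw [sum_const, card_univ, Fintype.card_fin, nsmul_eq_mul, ← mul_sum] at h2
    refine h2.trans (mul_le_mul_of_nonneg_left (le_trans (le_of_eq ?_) h) (by positivity))
    simp only [← expect_sum_comm]
  have hβ : 0 ≤ β := le_trans
    (expect_nonneg fun _ _ => expect_nonneg fun _ _ => sum_nonneg fun _ _ => hΦ _) h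
  have hm' : (0 : ℝ) < m := by exact_mod_cast hm
  have hmn' : (n : ℝ) ≤ 3 * m := by exact_mod_cast hmn
  refine le_of_mul_le_mul_left (h1.trans ?_) hm'
  have : (0 : ℝ) ≤ n ^ 3 * β := by positivity
  nlinarith

/-- Pigeonhole over the `n ^ 2` possible base cells. -/
lemma exists_base_le (Φ : ℝ → ℝ) (M : Fin n → Fin n → ℝ) (hn : 0 < n) {B : ℝ}
    (h : ∑ i, ∑ k, ∑ j, ∑ l, Φ (secDiff M i k j l) ≤ B * n ^ 3) :
    ∃ k l, ∑ i, ∑ j, Φ (secDiff M i k j l) ≤ B * n := by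
  have hne : (univ : Finset (Fin n × Fin n)).Nonempty := ⟨(⟨0, hn⟩, ⟨0, hn⟩), mem_univ _⟩
  obtain ⟨⟨k, l⟩, -, hkl⟩ := exists_le_of_sum_le (s := (univ : Finset (Fin n × Fin n)))
    (f := fun a => ∑ i, ∑ j, Φ (secDiff M i a.1 j a.2)) (g := fun _ => B * n) hne (by
      have h1 : ∑ a : Fin n × Fin n, ∑ i, ∑ j, Φ (secDiff M i a.1 j a.2)
          = ∑ i, ∑ k, ∑ j, ∑ l, Φ (secDiff M i k j l) := by
        rw [Fintype.sum_prod_type]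
        calc ∑ k, ∑ l, ∑ i, ∑ j, Φ (secDiff M i k j l)
            = ∑ k, ∑ i, ∑ l, ∑ j, Φ (secDiff M i k j l) :=
              sum_congr rfl fun k _ => sum_comm
          _ = ∑ k, ∑ i, ∑ j, ∑ l, Φ (secDiff M i k j l) :=
              sum_congr rfl fun k _ => sum_congr rfl fun i _ => sum_comm
          _ = _ := sum_comm
      rw [h1, sum_const, card_univ, Fintype.card_prod, Fintype.card_fin, nsmul_eq_mul]
      push_cast
      refine h.trans (le_of_eq ?_)
      ring)
  exact ⟨k, l, hkl⟩

/-- A Boolean function close to linear is close to a linear function with integer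
coefficients. -/
theorem exists_int_permSum (hn : 2 ≤ n) {f : S n → ℝ} (hf : IsBoolean f)
    (M : Fin n → Fin n → ℝ) {ε : ℝ} (h : 𝔼 π, (f π - permSum M π) ^ 2 ≤ ε) :
    ∃ (c : ℤ) (d : Fin n → Fin n → ℤ),
      𝔼 π, (f π - (c + permSum d π : ℤ)) ^ 2 ≤ 10760 * ε := by
  have hn' : (2 : ℝ) ≤ n := by exact_mod_cast hn
  obtain ⟨e⟩ := exists_pairs (n := n) (m := n / 2) (by omega)
  obtain ⟨η, hη, hcube⟩ := exists_cube_defect hf M 0 ε (by simpa using h) e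
  have hε : 0 ≤ ε := (expect_nonneg fun _ _ => sq_nonneg _).trans h
  let Φ : ℝ → ℝ := fun x => (x - round x) ^ 2
  have hQ := sum_secDiff_le_of_expect_le Φ (by simp [Φ]) (fun x => sq_nonneg _) M e (by omega)
    (by omega) (β := 224 * ε) (by
      refine (expect_le_expect fun ρ _ => expect_le_expect fun σ _ => (hcube ρ σ).1).trans ?_
      simp only [← mul_expect]
      linarith)
  obtain ⟨k, l, hkl⟩ := exists_base_le Φ M (by omega) hQ
  obtain ⟨c₁, hc₁⟩ := permSum_eq_secDiff_add M k l
  let d : Fin n → Fin n → ℤ := fun i j => round (secDiff M i k j l)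
  obtain ⟨μ, hμ⟩ := exists_expect_sq_sub_le hn fun i j => secDiff M i k j l - d i j
  have hvar : 𝔼 π, (permSum (fun i j => secDiff M i k j l - d i j) π - μ) ^ 2 ≤ 1344 * ε := by
    refine hμ.trans ?_
    rw [div_le_iff₀ (by linarith)]
    refine hkl.trans ?_
    nlinarith
  have hsum : ∀ π, permSum M π
      = c₁ + (permSum d π : ℤ) + permSum (fun i j => secDiff M i k j l - d i j) π := by
    intro π
    rw [hc₁]
    simp only [permSum, sum_sub_distrib]
    push_cast
    ring
  have hint : ∀ π, ∃ z : ℤ, f π - (permSum d π : ℤ) = z := by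
    intro π
    rcases hf π with h0 | h0 <;> rw [h0]
    · exact ⟨-permSum d π, by push_cast; ring⟩
    · exact ⟨1 - permSum d π, by push_cast; ring⟩
  -- Since `f π - permSum d π` is an integer, rounding `c₁ + μ` at most doubles its distance to that
  -- integer. The constant is `8 + 8 * 1344`, where `1344 = 2 * 3 * 224`.
  refine ⟨round (c₁ + μ), d, ?_⟩
  have hpt : ∀ π, (f π - (round (c₁ + μ) + permSum d π : ℤ)) ^ 2
      ≤ 8 * (f π - permSum M π) ^ 2
        + 8 * (permSum (fun i j => secDiff M i k j l - d i j) π - μ) ^ 2 := by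
    intro π
    obtain ⟨z, hz⟩ := hint π
    have h1 := round_le (c₁ + μ) z
    set u := permSum (fun i j => secDiff M i k j l - d i j) π with hu
    have h2 : |f π - (round (c₁ + μ) + permSum d π : ℤ)| ≤ 2 * |c₁ + μ - z| := by
      have : f π - (round (c₁ + μ) + permSum d π : ℤ)
          = (c₁ + μ - round (c₁ + μ)) - (c₁ + μ - z) := by
        push_cast
        linarith
      rw [this]
      linarith [abs_sub (c₁ + μ - round (c₁ + μ)) (c₁ + μ - z)]
    have h3 : (f π - (round (c₁ + μ) + permSum d π : ℤ)) ^ 2 ≤ (2 * (c₁ + μ - z)) ^ 2 := by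
      rw [sq_le_sq, abs_mul, abs_two]
      exact h2
    have h4 : c₁ + μ - z = -(f π - permSum M π) - (u - μ) := by
      rw [hsum π, ← hz]
      ring
    rw [h4] at h3
    nlinarith [sq_nonneg ((f π - permSum M π) - (u - μ))]
  refine (expect_le_expect fun π _ => hpt π).trans ?_
  rw [expect_add_distrib, ← mul_expect, ← mul_expect]
  linarith

end NearlyLinear

namespace NearlyLinear

variable {n m : ℕ}

/-! ### Exactly integer linear Boolean functions are dictators. -/

section Exact

lemma permSum_sub_potential (d : Fin n → Fin n → ℤ) (u v : Fin n → ℤ) (π : S n) :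
    permSum (fun i j => d i j - u i - v j) π = permSum d π - ∑ i, u i - ∑ j, v j := by
  rw [permSum, permSum, sum_sub_distrib, sum_sub_distrib, Equiv.sum_comp π v]

/-- Egerváry's theorem: integer potentials below a matrix which are tight on a permutation. -/
lemma exists_tight_potential (d : Fin n → Fin n → ℤ) :
    ∃ (u v : Fin n → ℤ) (τ : S n),
      (∀ i j, 0 ≤ d i j - u i - v j) ∧ ∀ i, d i (τ i) - u i - v (τ i) = 0 := by
  obtain ⟨z, ⟨u, v, huv, rfl⟩, hz⟩ := Int.exists_greatest_of_bdd
    (P := fun z => ∃ u v : Fin n → ℤ,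
      (∀ i j, 0 ≤ d i j - u i - v j) ∧ ∑ i, u i + ∑ j, v j = z) (by
    refine ⟨permSum d 1, ?_⟩
    rintro z ⟨u, v, huv, rfl⟩
    have h1 := permSum_sub_potential d u v 1
    have h2 : 0 ≤ permSum (fun i j => d i j - u i - v j) 1 := sum_nonneg fun i _ => huv i _
    linarith) (by
    refine ⟨_, fun i => -∑ j, |d i j|, fun _ => 0, fun i j => ?_, rfl⟩
    have h1 := single_le_sum (f := fun j => |d i j|) (fun j _ => abs_nonneg _) (mem_univ j)
    have h2 := neg_abs_le (d i j)
    linarith)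
  let t : Fin n → Finset (Fin n) := fun i => univ.filter fun j => d i j - u i - v j = 0
  -- Hall's condition for the tight cells: if `s` violated it, raising `u` by `1` on `s` and
  -- lowering `v` by `1` on its neighbours would increase the dual value. Integrality keeps the
  -- non-tight entries nonnegative.
  have hall : ∀ s : Finset (Fin n), s.card ≤ (s.biUnion t).card := by
    intro s
    by_contra! hlt
    have := hz _ ⟨fun i => u i + if i ∈ s then 1 else 0,
      fun j => v j - if j ∈ s.biUnion t then 1 else 0, fun i j => ?_, rfl⟩
    · simp only [sum_add_distrib, sum_sub_distrib, sum_ite_mem, univ_inter, sum_const,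
        nsmul_eq_mul, mul_one] at this
      omega
    · have hij := huv i j
      by_cases hi : i ∈ s <;> by_cases hj : j ∈ s.biUnion t <;> simp only [hi, hj, if_true, if_false]
      · linarith
      · have : d i j - u i - v j ≠ 0 := fun h0 =>
          hj (mem_biUnion.mpr ⟨i, hi, by simp [t, h0]⟩)
        omega
      · linarith
      · linarith
  obtain ⟨p, hp, hpt⟩ := (Finset.all_card_le_biUnion_card_iff_exists_injective t).mp hall
  refine ⟨u, v, Equiv.ofBijective p (Finite.injective_iff_bijective.mp hp), huv, fun i => ?_⟩
  simpa [t] using hpt i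

lemma exists_perm_apply_eq_and {i k j l : Fin n} (hik : i ≠ k) (hjl : j ≠ l) :
    ∃ π : S n, π i = j ∧ π k = l := by
  obtain ⟨τ, hτ⟩ := exists_perm_comp_eq (κ := Bool) (p := fun β => if β then i else k)
    (q := fun β => if β then j else l)
    (by intro β γ; cases β <;> cases γ <;> simp [hik, hik.symm])
    (by intro β γ; cases β <;> cases γ <;> simp [hjl, hjl.symm])
  exact ⟨τ, by simpa using hτ true, by simpa using hτ false⟩

/-- Cells are edges of a bipartite graph; pairwise incident edges form a star or a triangle, and a
bipartite graph has no triangle. -/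
lemma exists_line_of_pairwise_conflict (hn : 0 < n) (E : Fin n → Fin n → Prop)
    (h : ∀ i j k l, E i j → E k l → i = k ∨ j = l) :
    (∃ i, ∀ k l, E k l → k = i) ∨ ∃ j, ∀ k l, E k l → l = j := by
  by_contra! hcon
  obtain ⟨h1, h2⟩ := hcon
  obtain ⟨i, j, hij, -⟩ := h1 ⟨0, hn⟩
  obtain ⟨k, l, hkl, hki⟩ := h1 i
  obtain ⟨p, q, hpq, hqj⟩ := h2 j
  have := h _ _ _ _ hij hkl
  have := h _ _ _ _ hij hpq
  have := h _ _ _ _ hkl hpq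
  grind

/-- A Boolean function that is linear with integer coefficients is a dictator. -/
theorem isDictator_of_eq_permSum (hn : 0 < n) {f : S n → ℝ} (hf : IsBoolean f) (c : ℤ)
    (d : Fin n → Fin n → ℤ) (h : ∀ π, f π = (c + permSum d π : ℤ)) : IsDictator f := by
  obtain ⟨u, v, τ, hnn, hτ⟩ := exists_tight_potential d
  set a : Fin n → Fin n → ℤ := fun i j => d i j - u i - v j with ha
  have h0 : permSum a τ = 0 := sum_eq_zero fun i _ => hτ i
  have hfa : ∀ π, f π = f τ + (permSum a π : ℤ) := by
    intro π
    have h1 := permSum_sub_potential d u v π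
    have h2 := permSum_sub_potential d u v τ
    rw [h, h]
    push_cast
    have : ((permSum d π : ℤ) : ℝ) = (permSum d τ : ℤ) + (permSum a π : ℤ) := by
      have : permSum d π = permSum d τ + permSum a π := by linarith
      exact_mod_cast this
    rw [this]
    ring
  have hpos : ∀ π, 0 ≤ permSum a π := fun π => sum_nonneg fun i _ => hnn i _
  rcases hf τ with hfτ | hfτ
  -- With `f τ = 0`, the nonnegative integer sums of `a` are at most `1`, so no permutation meets
  -- two nonzero entries and those entries must lie on a line.
  · have hle : ∀ π, permSum a π ≤ 1 := by
      intro π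
      have h1 := hfa π
      rcases hf π with h2 | h2
      · have : ((permSum a π : ℤ) : ℝ) = 0 := by linarith
        have : permSum a π = 0 := by exact_mod_cast this
        omega
      · have : ((permSum a π : ℤ) : ℝ) = 1 := by linarith
        have : permSum a π = 1 := by exact_mod_cast this
        omega
    refine ⟨hf, ?_⟩
    rcases exists_line_of_pairwise_conflict hn (fun i j => a i j ≠ 0) (by
      intro i j k l hij hkl
      by_contra! hne
      obtain ⟨π, rfl, rfl⟩ := exists_perm_apply_eq_and hne.1 hne.2
      have h1 := hle π
      rw [permSum, ← add_sum_erase univ _ (mem_univ i),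
        ← add_sum_erase _ _ (mem_erase.mpr ⟨hne.1.symm, mem_univ k⟩)] at h1
      have h2 := sum_nonneg (s := (univ.erase i).erase k) (f := fun i => a i (π i))
        fun i _ => hnn i _
      have : 0 ≤ a i (π i) := hnn i (π i)
      have : 0 ≤ a k (π k) := hnn k (π k)
      have : a i (π i) ≠ 0 := hij
      have : a k (π k) ≠ 0 := hkl
      omega) with ⟨i, hi⟩ | ⟨j, hj⟩
    · refine Or.inl ⟨i, fun j => a i j, fun π => ?_⟩
      rw [hfa, hfτ, zero_add, permSum, sum_eq_single i]
      · intro k _ hk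
        by_contra hne
        exact hk (hi k _ hne)
      · simp
    · refine Or.inr ⟨j, fun i => a i j, fun π => ?_⟩
      rw [hfa, hfτ, zero_add, permSum, sum_eq_single (π⁻¹ j)]
      · simp
      · intro k _ hk
        by_contra hne
        refine hk ?_
        rw [← hj k _ hne]
        simp
      · simp
  · have hone : ∀ π, f π = 1 := by
      intro π
      rcases hf π with h2 | h2
      · have h1 := hfa π
        have : (0 : ℝ) ≤ (permSum a π : ℤ) := by exact_mod_cast hpos π
        linarith
      · exact h2
    exact ⟨hf, Or.inl ⟨⟨0, hn⟩, fun _ => 1, hone⟩⟩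

end Exact

/-! ### Sets of cells with few conflict-free pairs. -/

section Line

variable {α β : Type*} [DecidableEq α] [DecidableEq β]

/-- The number of ordered pairs of cells of `D` which share neither a row nor a column. -/
def conflictFree (p q : β → α) (D : Finset β) : ℕ :=
  ∑ a ∈ D, (D.filter fun b => p a ≠ p b ∧ q a ≠ q b).card

lemma conflictFree_swap (p q : β → α) (D : Finset β) :
    conflictFree q p D = conflictFree p q D := by
  simp only [conflictFree, and_comm]

/-- A cell off the line shares its other coordinate with at most one cell of the line, and so forms
a conflict-free pair with all the rest. -/
lemma card_off_line_mul_le (p q : β → α) (hpq : ∀ a b, p a = p b → q a = q b → a = b)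
    (D : Finset β) (i : α) :
    (D.filter fun b => p b ≠ i).card * ((D.filter fun b => p b = i).card - 1)
      ≤ conflictFree p q D := by
  have h1 : ∀ b ∈ D.filter fun b => p b ≠ i, (D.filter fun b => p b = i).card - 1
      ≤ (D.filter fun c => p b ≠ p c ∧ q b ≠ q c).card := by
    intro b hb
    have hb := (mem_filter.mp hb).2
    have h2 := card_filter_add_card_filter_not (s := D.filter fun b => p b = i)
      (fun c => q b ≠ q c)
    have h3 : ((D.filter fun b => p b = i).filter fun c => ¬ q b ≠ q c).card ≤ 1 := by
      rw [card_le_one]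
      intro c hc c' hc'
      simp only [mem_filter, not_not] at hc hc'
      exact hpq _ _ (hc.1.2.trans hc'.1.2.symm) (hc.2.symm.trans hc'.2)
    have h4 : ((D.filter fun b => p b = i).filter fun c => q b ≠ q c).card
        ≤ (D.filter fun c => p b ≠ p c ∧ q b ≠ q c).card := by
      refine card_le_card fun c hc => ?_
      simp only [mem_filter] at hc ⊢
      refine ⟨hc.1.1, fun h => hb (h.trans hc.1.2), hc.2⟩
    omega
  calc _ = ∑ b ∈ D.filter fun b => p b ≠ i, ((D.filter fun b => p b = i).card - 1) := by
        rw [sum_const, smul_eq_mul]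
    _ ≤ ∑ b ∈ D.filter fun b => p b ≠ i, (D.filter fun c => p b ≠ p c ∧ q b ≠ q c).card :=
        sum_le_sum h1
    _ ≤ _ := sum_le_sum_of_subset (filter_subset _ _)

/-- A set of cells with few conflict-free pairs is nearly contained in a line. -/
theorem exists_line_of_conflictFree_le (p q : β → α)
    (hpq : ∀ a b, p a = p b → q a = q b → a = b) {D : Finset β} (hD : D.Nonempty)
    (h : 10 * conflictFree p q D ≤ D.card ^ 2) :
    (∃ i, D.card * (D.filter fun b => p b ≠ i).card ≤ 4 * conflictFree p q D) ∨
      ∃ j, D.card * (D.filter fun b => q b ≠ j).card ≤ 4 * conflictFree p q D := by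
  obtain ⟨a, haD, ha⟩ := exists_le_of_sum_le (s := D)
    (f := fun a => D.card * (D.filter fun b => p a ≠ p b ∧ q a ≠ q b).card)
    (g := fun _ => conflictFree p q D) hD (by
      rw [← mul_sum, sum_const, smul_eq_mul, conflictFree])
  have hcard := hD.card_pos
  have ha' : 10 * (D.filter fun b => p a ≠ p b ∧ q a ≠ q b).card ≤ D.card := by
    refine Nat.le_of_mul_le_mul_left ?_ hcard
    nlinarith
  set N := (D.filter fun b => p a ≠ p b ∧ q a ≠ q b).card
  have e1 := card_filter_add_card_filter_not (s := D) fun b => p b = p a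
  have e2 := card_filter_add_card_filter_not (s := D) fun b => q b = q a
  have e3 := card_filter_add_card_filter_not (s := D.filter fun b => p b ≠ p a)
    fun b => q b = q a
  have e4 : ((D.filter fun b => p b ≠ p a).filter fun b => ¬ q b = q a).card = N := by
    rw [filter_filter]
    congr 1
    refine filter_congr fun b _ => ?_
    simp only [ne_eq, eq_comm]
  have e5 : ((D.filter fun b => p b ≠ p a).filter fun b => q b = q a).card + 1
      ≤ (D.filter fun b => q b = q a).card := by
    rw [← card_erase_add_one (s := D.filter fun b => q b = q a) (a := a) (by simp [haD])]
    refine Nat.add_le_add_right (card_le_card fun b hb => ?_) 1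
    simp only [mem_filter, mem_erase] at hb ⊢
    exact ⟨fun h => hb.1.2 (by rw [h]), hb.1.1, hb.2⟩
  have hp := card_off_line_mul_le p q hpq D (p a)
  have hq := card_off_line_mul_le q p (fun a b h1 h2 => hpq a b h2 h1) D (q a)
  rw [conflictFree_swap] at hq
  have hp1 : 1 ≤ (D.filter fun b => p b = p a).card := card_pos.mpr ⟨a, by simp [haD]⟩
  set r := (D.filter fun b => p b = p a).card
  set r' := (D.filter fun b => q b = q a).card
  set o := (D.filter fun b => p b ≠ p a).card
  set o' := (D.filter fun b => q b ≠ q a).card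
  change r + o = D.card at e1
  change r' + o' = D.card at e2
  -- All but `N ≤ D.card / 10` cells lie on one of the two lines through `a`, so one of these is
  -- rich. A single cell is separate because `r - 1` and `r' - 1` then vanish.
  rcases (by omega : D.card = 1 ∨ D.card ≤ 4 * (r - 1) ∨ D.card ≤ 4 * (r' - 1)) with h1 | h1 | h1
  · left
    refine ⟨p a, ?_⟩
    change D.card * o ≤ _
    have : o = 0 := by omega
    rw [this]
    simp
  · left
    refine ⟨p a, ?_⟩
    change D.card * o ≤ _
    nlinarith
  · right
    refine ⟨q a, ?_⟩
    change D.card * o' ≤ _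
    nlinarith

end Line

end NearlyLinear

namespace NearlyLinear

variable {n m : ℕ}

/-! ### Integer matrices of minimal support modulo row and column shifts. -/

section MinimalSupport

/-- The number of nonzero entries of a matrix. -/
def suppCard (d : Fin n → Fin n → ℤ) : ℕ := ∑ i, ∑ j, if d i j ≠ 0 then 1 else 0

/-- No matrix differing from `d` by row and column shifts has fewer nonzero entries. -/
def MinSupport (d : Fin n → Fin n → ℤ) : Prop :=
  ∀ u v : Fin n → ℤ, suppCard d ≤ suppCard fun i j => d i j - u i - v j

lemma exists_minSupport (d : Fin n → Fin n → ℤ) :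
    ∃ u v : Fin n → ℤ, MinSupport fun i j => d i j - u i - v j := by
  let s : Set ℕ := Set.range fun a : (Fin n → ℤ) × (Fin n → ℤ) =>
    suppCard fun i j => d i j - a.1 i - a.2 j
  have hs : s.Nonempty := Set.range_nonempty _
  obtain ⟨⟨u, v⟩, huv⟩ := Nat.sInf_mem hs
  refine ⟨u, v, fun u' v' => ?_⟩
  refine (le_of_eq huv).trans (Nat.sInf_le ⟨(fun i => u i + u' i, fun j => v j + v' j), ?_⟩)
  simp only
  congr 1
  funext i j
  ring

lemma MinSupport.transpose {d : Fin n → Fin n → ℤ} (h : MinSupport d) :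
    MinSupport fun i j => d j i := by
  have ht : ∀ a : Fin n → Fin n → ℤ, suppCard (fun i j => a j i) = suppCard a := fun a =>
    sum_comm
  intro u v
  rw [ht d]
  refine (h v u).trans (le_of_eq ?_)
  rw [← ht]
  congr 1
  funext i j
  ring

/-- Subtracting `v` from row `i` trades its zeros for its entries equal to `v`. By minimality the
latter are no more numerous than the former. -/
lemma MinSupport.two_mul_card_le {d : Fin n → Fin n → ℤ} (h : MinSupport d) (i : Fin n) {v : ℤ}
    (hv : v ≠ 0) : 2 * (univ.filter fun j => d i j = v).card ≤ n := by
  have h1 := h (Pi.single i v) 0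
  rw [suppCard, suppCard, ← add_sum_erase univ _ (mem_univ i),
    ← add_sum_erase univ (fun k => ∑ j, if d k j - (Pi.single i v : Fin n → ℤ) k
      - (0 : Fin n → ℤ) j ≠ 0 then 1 else 0) (mem_univ i)] at h1
  have h2 : ∑ k ∈ univ.erase i, ∑ j, (if d k j - (Pi.single i v : Fin n → ℤ) k
      - (0 : Fin n → ℤ) j ≠ 0 then 1 else 0)
      = ∑ k ∈ univ.erase i, ∑ j, if d k j ≠ 0 then 1 else 0 := by
    refine sum_congr rfl fun k hk => ?_
    simp [Pi.single_eq_of_ne (mem_erase.mp hk).1]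
  rw [h2] at h1
  have h3 := Nat.le_of_add_le_add_right h1
  simp only [Pi.single_eq_same, Pi.zero_apply, sub_zero, sum_boole, Nat.cast_id] at h3
  have h4 := card_filter_add_card_filter_not (s := (univ : Finset (Fin n)))
    fun j => d i j - v ≠ 0
  have h5 : (univ.filter fun j => ¬ (d i j - v ≠ 0)) = univ.filter fun j => d i j = v := by
    refine filter_congr fun j _ => ?_
    rw [not_not, sub_eq_zero]
  have h6 : (univ.filter fun j => d i j = v).card ≤ (univ.filter fun j => d i j ≠ 0).card :=
    card_le_card fun j hj => by
      simp only [mem_filter, mem_univ, true_and] at hj ⊢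
      rw [hj]
      exact hv
  rw [h5, card_univ, Fintype.card_fin] at h4
  omega

/-- Fix the column `l`. Unless `d i l = v`, column `j` must take a prescribed nonzero value, which
happens for at most half the rows; the exceptional `l` are at most half of all. This gives `1/2 +
1/4`. -/
lemma MinSupport.card_add_eq_le {d : Fin n → Fin n → ℤ} (h : MinSupport d) (i j : Fin n) {v : ℤ}
    (hv : v ≠ 0) :
    4 * (univ.filter fun a : Fin n × Fin n => d i a.2 + d a.1 j = v).card ≤ 3 * n ^ 2 := by
  have h1 : (univ.filter fun a : Fin n × Fin n => d i a.2 + d a.1 j = v).card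
      = ∑ l, (univ.filter fun k => d k j = v - d i l).card := by
    simp only [card_filter]
    rw [Fintype.sum_prod_type, sum_comm]
    refine sum_congr rfl fun l _ => sum_congr rfl fun k _ => ?_
    refine if_congr ?_ rfl rfl
    constructor <;> intro h <;> linarith
  have h2 : ∀ l, 2 * (univ.filter fun k => d k j = v - d i l).card
      ≤ n + if d i l = v then n else 0 := by
    intro l
    split_ifs with hl
    · have := card_le_univ (univ.filter fun k => d k j = v - d i l)
      rw [Fintype.card_fin] at this
      omega
    · simpa using h.transpose.two_mul_card_le j (v := v - d i l)
        (sub_ne_zero.mpr (Ne.symm hl))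
  have h3 := sum_le_sum fun l (_ : l ∈ univ) => h2 l
  rw [← mul_sum, ← h1, sum_add_distrib, ← sum_filter, sum_const, sum_const, card_univ,
    Fintype.card_fin, smul_eq_mul, smul_eq_mul] at h3
  have h4 := h.two_mul_card_le i hv
  nlinarith

/-- The cells of the nonzero entries of a matrix. -/
def supp (d : Fin n → Fin n → ℤ) : Finset (Fin n × Fin n) := univ.filter fun a => d a.1 a.2 ≠ 0

lemma card_supp (d : Fin n → Fin n → ℤ) : (supp d).card = suppCard d := by
  rw [supp, card_filter, Fintype.sum_prod_type, suppCard]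

/-- The cells which together with the cell `c` span a nonzero second difference. -/
def partners (d : Fin n → Fin n → ℤ) (c : Fin n × Fin n) : Finset (Fin n × Fin n) :=
  univ.filter fun x => secDiff d c.1 x.1 c.2 x.2 ≠ 0

/-- At least a quarter of the opposite corners `x` have `d c.1 x.2 + d x.1 c.2 ≠ d c.1 c.2`, and
each of those is a partner unless it lies in the support itself. -/
lemma MinSupport.card_partners {d : Fin n → Fin n → ℤ} (h : MinSupport d) {c : Fin n × Fin n}
    (hc : c ∈ supp d) : n ^ 2 ≤ 4 * ((partners d c).card + suppCard d) := by
  have h1 := h.card_add_eq_le c.1 c.2 (mem_filter.mp hc).2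
  have h2 := card_filter_add_card_filter_not (s := (univ : Finset (Fin n × Fin n)))
    fun a => d c.1 a.2 + d a.1 c.2 = d c.1 c.2
  have h3 : (univ.filter fun a : Fin n × Fin n => ¬ d c.1 a.2 + d a.1 c.2 = d c.1 c.2)
      ⊆ partners d c ∪ supp d := by
    intro a ha
    have ha := (mem_filter.mp ha).2
    by_cases hz : d a.1 a.2 = 0
    · refine mem_union_left _ (mem_filter.mpr ⟨mem_univ _, fun h0 => ha ?_⟩)
      rw [secDiff, hz] at h0
      linarith
    · exact mem_union_right _ (mem_filter.mpr ⟨mem_univ _, hz⟩)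
  have h4 := (card_le_card h3).trans (card_union_le _ _)
  rw [card_supp] at h4
  rw [card_univ, Fintype.card_prod, Fintype.card_fin] at h2
  nlinarith

end MinimalSupport

/-! ### Counting pairs of quadruples with nonzero second differences. -/

section Counting

lemma card_le_pow_three_of_injOn {s : Finset ((Fin n × Fin n) × (Fin n × Fin n))}
    (g : (Fin n × Fin n) × (Fin n × Fin n) → Fin n × Fin n × Fin n) (hg : Set.InjOn g s) :
    s.card ≤ n ^ 3 := by
  have := card_le_card_of_injOn (t := univ) g (fun _ _ => mem_univ _) hg
  simp only [card_univ, Fintype.card_prod, Fintype.card_fin] at this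
  refine this.trans (le_of_eq ?_)
  ring

/-- The pairs of cells completing `c` and `c'` to two quadruples on disjoint rows and columns. -/
def partnerPairs (d : Fin n → Fin n → ℤ) (c c' : Fin n × Fin n) :
    Finset ((Fin n × Fin n) × (Fin n × Fin n)) :=
  (partners d c ×ˢ partners d c').filter fun x =>
    (x.1.1 ≠ c'.1 ∧ x.2.1 ≠ c.1 ∧ x.1.1 ≠ x.2.1) ∧
      (x.1.2 ≠ c'.2 ∧ x.2.2 ≠ c.2 ∧ x.1.2 ≠ x.2.2)

/-- Each of the six forbidden coincidences removes one of four degrees of freedom, hence at most `n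
^ 3` pairs. -/
lemma card_partners_mul_le (d : Fin n → Fin n → ℤ) (c c' : Fin n × Fin n) :
    (partners d c).card * (partners d c').card ≤ (partnerPairs d c c').card + 6 * n ^ 3 := by
  rw [← card_product]
  let T : Finset ((Fin n × Fin n) × (Fin n × Fin n)) := univ
  have h1 : (T.filter fun x => x.1.1 = c'.1).card ≤ n ^ 3 :=
    card_le_pow_three_of_injOn (fun x => (x.1.2, x.2.1, x.2.2)) (by
      rintro ⟨⟨_, _⟩, _, _⟩ hx ⟨⟨_, _⟩, _, _⟩ hy h
      simp_all [T])
  have h2 : (T.filter fun x => x.2.1 = c.1).card ≤ n ^ 3 :=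
    card_le_pow_three_of_injOn (fun x => (x.1.1, x.1.2, x.2.2)) (by
      rintro ⟨⟨_, _⟩, _, _⟩ hx ⟨⟨_, _⟩, _, _⟩ hy h
      simp_all [T])
  have h3 : (T.filter fun x => x.1.1 = x.2.1).card ≤ n ^ 3 :=
    card_le_pow_three_of_injOn (fun x => (x.1.1, x.1.2, x.2.2)) (by
      rintro ⟨⟨_, _⟩, _, _⟩ hx ⟨⟨_, _⟩, _, _⟩ hy h
      simp_all [T])
  have h4 : (T.filter fun x => x.1.2 = c'.2).card ≤ n ^ 3 :=
    card_le_pow_three_of_injOn (fun x => (x.1.1, x.2.1, x.2.2)) (by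
      rintro ⟨⟨_, _⟩, _, _⟩ hx ⟨⟨_, _⟩, _, _⟩ hy h
      simp_all [T])
  have h5 : (T.filter fun x => x.2.2 = c.2).card ≤ n ^ 3 :=
    card_le_pow_three_of_injOn (fun x => (x.1.1, x.1.2, x.2.1)) (by
      rintro ⟨⟨_, _⟩, _, _⟩ hx ⟨⟨_, _⟩, _, _⟩ hy h
      simp_all [T])
  have h6 : (T.filter fun x => x.1.2 = x.2.2).card ≤ n ^ 3 :=
    card_le_pow_three_of_injOn (fun x => (x.1.1, x.1.2, x.2.1)) (by
      rintro ⟨⟨_, _⟩, _, _⟩ hx ⟨⟨_, _⟩, _, _⟩ hy h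
      simp_all [T])
  have hsub : partners d c ×ˢ partners d c' ⊆ partnerPairs d c c' ∪
      ((T.filter fun x => x.1.1 = c'.1) ∪ ((T.filter fun x => x.2.1 = c.1) ∪
      ((T.filter fun x => x.1.1 = x.2.1) ∪ ((T.filter fun x => x.1.2 = c'.2) ∪
      ((T.filter fun x => x.2.2 = c.2) ∪ (T.filter fun x => x.1.2 = x.2.2)))))) := by
    intro x hx
    simp only [partnerPairs, T, mem_union, mem_filter, mem_univ, true_and]
    tauto
  have h := (card_le_card hsub).trans (card_union_le _ _)
  have i1 := card_union_le (T.filter fun x => x.1.1 = c'.1)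
    ((T.filter fun x => x.2.1 = c.1) ∪
      ((T.filter fun x => x.1.1 = x.2.1) ∪ ((T.filter fun x => x.1.2 = c'.2) ∪
      ((T.filter fun x => x.2.2 = c.2) ∪ (T.filter fun x => x.1.2 = x.2.2)))))
  have i2 := card_union_le (T.filter fun x => x.2.1 = c.1)
      ((T.filter fun x => x.1.1 = x.2.1) ∪ ((T.filter fun x => x.1.2 = c'.2) ∪
      ((T.filter fun x => x.2.2 = c.2) ∪ (T.filter fun x => x.1.2 = x.2.2))))
  have i3 := card_union_le (T.filter fun x => x.1.1 = x.2.1) ((T.filter fun x => x.1.2 = c'.2) ∪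
      ((T.filter fun x => x.2.2 = c.2) ∪ (T.filter fun x => x.1.2 = x.2.2)))
  have i4 := card_union_le (T.filter fun x => x.1.2 = c'.2)
      ((T.filter fun x => x.2.2 = c.2) ∪ (T.filter fun x => x.1.2 = x.2.2))
  have i5 := card_union_le (T.filter fun x => x.2.2 = c.2) (T.filter fun x => x.1.2 = x.2.2)
  omega

/-- The indicator of being nonzero. -/
noncomputable def ind (x : ℝ) : ℝ := if x = 0 then 0 else 1

lemma ind_nonneg (x : ℝ) : 0 ≤ ind x := by
  unfold ind
  split_ifs <;> norm_num

lemma ind_mul_self (x : ℝ) : ind x * ind x = ind x := by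
  unfold ind
  split_ifs <;> norm_num

lemma ind_intCast_le_sq (z : ℤ) : ind z ≤ (z : ℝ) ^ 2 := by
  unfold ind
  split_ifs with h
  · positivity
  · have : (1 : ℤ) ≤ z ^ 2 := by
      have : z ≠ 0 := by exact_mod_cast h
      have := Int.one_le_abs this
      nlinarith [sq_abs z]
    exact_mod_cast this

/-- The product of the indicators that two quadruples have nonzero second differences. -/
noncomputable def indPair (M : Fin n → Fin n → ℝ) (a b : Bool × Bool → Fin n) : ℝ :=
  ind (secDiff M (a (false, false)) (a (false, true)) (b (false, false)) (b (false, true))) *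
    ind (secDiff M (a (true, false)) (a (true, true)) (b (true, false)) (b (true, true)))

lemma indPair_nonneg (M : Fin n → Fin n → ℝ) (a b : Bool × Bool → Fin n) : 0 ≤ indPair M a b :=
  mul_nonneg (ind_nonneg _) (ind_nonneg _)

/-- The rows (or columns) of two quadruples with given corners. -/
def corners (i i' k k' : Fin n) : Bool × Bool → Fin n
  | (false, false) => i
  | (false, true) => i'
  | (true, false) => k
  | (true, true) => k'

lemma corners_injective {i i' k k' : Fin n} (h1 : i' ≠ i) (h2 : k' ≠ k) (h3 : i ≠ k)
    (h4 : i' ≠ k) (h5 : k' ≠ i) (h6 : i' ≠ k') : (corners i i' k k').Injective := by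
  rintro ⟨β, γ⟩ ⟨β', γ'⟩
  cases β <;> cases γ <;> cases β' <;> cases γ' <;> simp [corners] <;> tauto

lemma ne_of_mem_partners {d : Fin n → Fin n → ℤ} {c x : Fin n × Fin n} (h : x ∈ partners d c) :
    x.1 ≠ c.1 ∧ x.2 ≠ c.2 := by
  have h := (mem_filter.mp h).2
  constructor <;> intro he <;> refine h ?_ <;> rw [secDiff, he] <;> ring

lemma secDiff_intCast (d : Fin n → Fin n → ℤ) (i k j l : Fin n) :
    secDiff (fun i j => (d i j : ℝ)) i k j l = (secDiff d i k j l : ℤ) := by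
  simp [secDiff]

/-- Two cells with a pair of partners determine, injectively, four distinct rows and four distinct
columns on which `indPair` equals `1`. -/
lemma sum_card_partnerPairs_le (d : Fin n → Fin n → ℤ) {p : Bool × Bool → Fin n}
    (hp : p.Injective) :
    ((∑ c ∈ supp d, ∑ c' ∈ (supp d).filter fun b => c.1 ≠ b.1 ∧ c.2 ≠ b.2,
      (partnerPairs d c c').card : ℕ) : ℝ)
      ≤ (n : ℝ) ^ 8 * 𝔼 ρ : S n, 𝔼 σ : S n,
        indPair (fun i j => (d i j : ℝ)) (fun k => ρ (p k)) (fun k => σ (p k)) := by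
  classical
  set M : Fin n → Fin n → ℝ := fun i j => d i j with hM
  have h := sum_injective_le hp
    (fun a b => if a.Injective ∧ b.Injective then indPair M a b else 0)
    (fun a b => by split_ifs; exacts [indPair_nonneg _ _ _, le_rfl])
    (fun a b ha => if_neg fun h => ha h.1) (fun a b hb => if_neg fun h => hb h.2)
  have hinj : ∀ ρ : S n, (fun k => ρ (p k)).Injective := fun ρ => ρ.injective.comp hp
  simp only [hinj, and_self, if_true, Fintype.card_fin, Fintype.card_prod, Fintype.card_bool,
    ← pow_mul] at h
  refine le_trans ?_ h
  let U : Finset ((Bool × Bool → Fin n) × (Bool × Bool → Fin n)) :=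
    univ.filter fun a => (a.1.Injective ∧ a.2.Injective) ∧ indPair M a.1 a.2 = 1
  have hU : (U.card : ℝ) ≤ ∑ a, ∑ b,
      if a.Injective ∧ b.Injective then indPair M a b else 0 := by
    rw [← Fintype.sum_prod_type']
    rw [card_filter]
    push_cast
    refine sum_le_sum fun a _ => ?_
    split_ifs with h1 h2 h2
    · exact h1.2.ge
    · exact absurd h1.1 h2
    · exact indPair_nonneg _ _ _
    · exact le_rfl
  refine le_trans (Nat.cast_le.mpr ?_) hU
  rw [← sum_congr rfl fun c _ => card_sigma _ (partnerPairs d c), ← card_sigma]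
  refine card_le_card_of_injOn (fun t => (corners t.1.1 t.2.2.1.1 t.2.1.1 t.2.2.2.1,
    corners t.1.2 t.2.2.1.2 t.2.1.2 t.2.2.2.2)) ?_ ?_
  · rintro ⟨c, c', x, x'⟩ ht
    simp only [coe_sigma, Set.mem_sigma_iff, mem_coe, mem_filter, partnerPairs, mem_product] at ht
    obtain ⟨hc, ⟨hc', hcc⟩, ⟨hx, hx'⟩, h1, h2⟩ := ht
    have e1 := ne_of_mem_partners hx
    have e2 := ne_of_mem_partners hx'
    simp only [U, coe_filter, mem_univ, true_and, Set.mem_ofPred_eq]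
    refine ⟨⟨corners_injective e1.1 e2.1 hcc.1 h1.1 h1.2.1 h1.2.2,
      corners_injective e1.2 e2.2 hcc.2 h2.1 h2.2.1 h2.2.2⟩, ?_⟩
    have f1 := (mem_filter.mp hx).2
    have f2 := (mem_filter.mp hx').2
    simp only [indPair, corners, hM, secDiff_intCast, ind, Int.cast_eq_zero, f1, f2, if_false,
      mul_one]
  · rintro ⟨⟨_, _⟩, ⟨_, _⟩, ⟨_, _⟩, _, _⟩ - ⟨⟨_, _⟩, ⟨_, _⟩, ⟨_, _⟩, _, _⟩ - h
    have h1 := congrFun (congrArg Prod.fst h)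
    have h2 := congrFun (congrArg Prod.snd h)
    have a1 := h1 (false, false)
    have a2 := h1 (false, true)
    have a3 := h1 (true, false)
    have a4 := h1 (true, true)
    have b1 := h2 (false, false)
    have b2 := h2 (false, true)
    have b3 := h2 (true, false)
    have b4 := h2 (true, true)
    simp only [corners] at a1 a2 a3 a4 b1 b2 b3 b4
    subst a1 a2 a3 a4 b1 b2 b3 b4
    rfl

end Counting

end NearlyLinear

namespace NearlyLinear

variable {n m : ℕ}

/-! ### Triples of quadruples and a Bonferroni inequality. -/

section Pairs

/-- The four positions of the pairs number `s` and `t`. -/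
def twoPairs (e : Fin m × Bool ↪ Fin n) (s t : Fin m) : Bool × Bool → Fin n :=
  fun a => e (if a.1 then t else s, a.2)

lemma twoPairs_injective (e : Fin m × Bool ↪ Fin n) {s t : Fin m} (hst : s ≠ t) :
    (twoPairs e s t).Injective := by
  rintro ⟨β, γ⟩ ⟨β', γ'⟩ h
  have := e.injective h
  cases β <;> cases β' <;> simp_all

/-- A third quadruple is nonzero with small probability, whatever the first two are. -/
lemma expect_triple_le (M : Fin n → Fin n → ℝ) (e : Fin m × Bool ↪ Fin n) {s t r : Fin m}
    (hst : s ≠ t) (hrs : r ≠ s) (hrt : r ≠ t) :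
    (((n : ℝ) - 4) * (n - 5)) ^ 2 * 𝔼 ρ, 𝔼 σ, ind (pairDiff M e ρ σ s) * ind (pairDiff M e ρ σ t)
        * ind (pairDiff M e ρ σ r)
      ≤ (∑ i, ∑ k, ∑ j, ∑ l, ind (secDiff M i k j l))
        * 𝔼 ρ, 𝔼 σ, ind (pairDiff M e ρ σ s) * ind (pairDiff M e ρ σ t) := by
  let p := twoPairs e s t
  have hp : p.Injective := twoPairs_injective e hst
  let O : Finset (Fin n) := (univ.image p)ᶜ
  have hO : O.card + 4 = n := by
    have := card_compl_add_card (univ.image p)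
    rw [card_image_of_injective _ hp] at this
    simpa [O] using this
  have hOp : ∀ k a, a ∈ O → p k ≠ a := by
    intro k a ha h
    simp only [O, mem_compl, mem_image, mem_univ, true_and, not_exists] at ha
    exact ha k h
  set X := 𝔼 ρ, 𝔼 σ, ind (pairDiff M e ρ σ s) * ind (pairDiff M e ρ σ t)
        * ind (pairDiff M e ρ σ r) with hX
  have hq : ∀ a ∈ O.offDiag, (Sum.elim p fun β : Bool => if β then a.2 else a.1).Injective := by
    rintro ⟨a, b⟩ hab
    obtain ⟨ha, hb, hne⟩ := mem_offDiag.mp hab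
    refine hp.sumElim ?_ ?_
    · intro β γ; cases β <;> cases γ <;> simp [hne, hne.symm]
    · intro k β
      cases β
      · exact hOp k a ha
      · exact hOp k b hb
  have hp' : (Sum.elim p fun β : Bool => e (r, β)).Injective := by
    refine hp.sumElim (fun β γ h => by simpa using h) ?_
    rintro ⟨β, γ⟩ δ h
    have := e.injective h
    cases β <;> simp_all
  -- The third quadruple may use any ordered pairs of unused positions; summing over all of them,
  -- with the first two quadruples fixed, is bounded by the global count.
  have hX' : ∀ a ∈ O.offDiag, ∀ b ∈ O.offDiag, X = 𝔼 ρ : S n, 𝔼 σ : S n,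
      ind (pairDiff M e ρ σ s) * ind (pairDiff M e ρ σ t)
        * ind (secDiff M (ρ a.1) (ρ a.2) (σ b.1) (σ b.2)) := by
    intro a ha b hb
    exact expect_comp_perm_eq₂ hp' (hq a ha) hp' (hq b hb) fun u v =>
      indPair M (fun k => u (Sum.inl k)) (fun k => v (Sum.inl k)) *
        ind (secDiff M (u (Sum.inr false)) (u (Sum.inr true)) (v (Sum.inr false))
          (v (Sum.inr true)))
  have hcard : (O.offDiag.card : ℝ) = (n - 4) * (n - 5) := by
    have h1 : (O.card : ℝ) = n - 4 := by
      have : (O.card : ℝ) + 4 = n := by exact_mod_cast hO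
      linarith
    rw [offDiag_card, Nat.cast_sub (Nat.le_mul_self _), Nat.cast_mul, h1]
    ring
  have hsum : ∑ a ∈ O.offDiag, ∑ b ∈ O.offDiag, X = (((n : ℝ) - 4) * (n - 5)) ^ 2 * X := by
    simp only [sum_const, nsmul_eq_mul, hcard]
    ring
  rw [← hsum, sum_congr rfl fun a ha => sum_congr rfl fun b hb => hX' a ha b hb]
  simp only [← expect_sum_comm, ← mul_sum]
  rw [mul_expect]
  refine expect_le_expect fun ρ _ => ?_
  rw [mul_expect]
  refine expect_le_expect fun σ _ => ?_
  rw [mul_comm]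
  refine mul_le_mul_of_nonneg_right ?_ (mul_nonneg (ind_nonneg _) (ind_nonneg _))
  have h1 : ∑ i, ∑ k, ∑ j, ∑ l, ind (secDiff M i k j l)
      = ∑ a : Fin n × Fin n, ∑ b : Fin n × Fin n,
        ind (secDiff M (ρ a.1) (ρ a.2) (σ b.1) (σ b.2)) := by
    rw [Fintype.sum_prod_type, ← Equiv.sum_comp ρ]
    refine sum_congr rfl fun i _ => ?_
    rw [← Equiv.sum_comp ρ]
    refine sum_congr rfl fun k _ => ?_
    rw [Fintype.sum_prod_type, ← Equiv.sum_comp σ]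
    refine sum_congr rfl fun j _ => ?_
    rw [← Equiv.sum_comp σ]
  rw [h1]
  refine (sum_le_sum fun a _ => sum_le_sum_of_subset_of_nonneg (subset_univ _)
    fun _ _ _ => ind_nonneg _).trans ?_
  exact sum_le_sum_of_subset_of_nonneg (subset_univ _)
    fun _ _ _ => sum_nonneg fun _ _ => ind_nonneg _

/-- A Bonferroni type inequality for `0`-`1` valued quantities. -/
lemma sum_mul_one_sub_le {ι : Type*} [Fintype ι] [DecidableEq ι] (x : ι → ℝ) {β : ℝ} (hβ : 0 ≤ β)
    (h : ∀ s t, s ≠ t → ind (x s) * ind (x t) ≤ β) :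
    ∑ s, ∑ t ∈ univ.erase s, ind (x s) * ind (x t)
      * (1 - ∑ r ∈ (univ.erase s).erase t, ind (x r)) ≤ 2 * β := by
  obtain ⟨N, hN⟩ : ∃ N : ℕ, ∑ s, ind (x s) = N := by
    refine ⟨(univ.filter fun s => x s ≠ 0).card, ?_⟩
    rw [card_filter]
    push_cast
    refine sum_congr rfl fun s _ => ?_
    simp only [ind, ne_eq, ite_not]
  -- With `N` nonzero values the double sum is `(3 - N) * N * (N - 1)`, which is positive only for
  -- `N = 2`, where it equals `2`.
  have h1 : ∀ s, ∀ t ∈ univ.erase s, ind (x s) * ind (x t)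
      * (1 - ∑ r ∈ (univ.erase s).erase t, ind (x r)) = (3 - N) * (ind (x s) * ind (x t)) := by
    intro s t ht
    have e1 := add_sum_erase univ (fun r => ind (x r)) (mem_univ s)
    have e2 := add_sum_erase (univ.erase s) (fun r => ind (x r)) ht
    have : ∑ r ∈ (univ.erase s).erase t, ind (x r) = N - ind (x s) - ind (x t) := by
      rw [← hN]
      linarith
    rw [this]
    linear_combination ind (x t) * ind_mul_self (x s) + ind (x s) * ind_mul_self (x t)
  have h2 : ∑ s, ∑ t ∈ univ.erase s, ind (x s) * ind (x t) = N * (N - 1) := by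
    have : ∀ s, ∑ t ∈ univ.erase s, ind (x s) * ind (x t) = ind (x s) * (N - 1) := by
      intro s
      have e1 := add_sum_erase univ (fun r => ind (x r)) (mem_univ s)
      rw [← mul_sum]
      have : ∑ r ∈ univ.erase s, ind (x r) = N - ind (x s) := by
        rw [← hN]
        linarith
      rw [this]
      linear_combination -ind_mul_self (x s)
    rw [sum_congr rfl fun s _ => this s, ← sum_mul, hN]
  rw [sum_congr rfl fun s _ => sum_congr rfl (h1 s)]
  rw [sum_congr rfl fun s _ => (mul_sum _ _ _).symm, ← mul_sum, h2]
  rcases Nat.lt_or_ge N 3 with h3 | h3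
  · interval_cases N
    · simpa using hβ
    · simpa using hβ
    · have h5 : ∃ s t, s ≠ t ∧ ind (x s) * ind (x t) = 1 := by
        by_contra! hcon
        have : ∑ s, ∑ t ∈ univ.erase s, ind (x s) * ind (x t) = 0 := by
          refine sum_eq_zero fun s _ => sum_eq_zero fun t ht => ?_
          have := hcon s t (mem_erase.mp ht).1.symm
          unfold ind at this ⊢
          split_ifs at this ⊢ <;> simp_all
        rw [this] at h2
        norm_num at h2
      obtain ⟨s, t, hst, h6⟩ := h5
      have := h s t hst
      rw [h6] at this
      push_cast
      linarith
  · have h3' : (3 : ℝ) ≤ N := by exact_mod_cast h3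
    have : (3 - (N : ℝ)) * (N * (N - 1)) ≤ 0 :=
      mul_nonpos_of_nonpos_of_nonneg (by linarith) (by nlinarith)
    linarith

end Pairs

end NearlyLinear

namespace NearlyLinear

variable {n m : ℕ}

lemma intCast_permSum (d : Fin n → Fin n → ℤ) (π : S n) :
    ((permSum d π : ℤ) : ℝ) = permSum (fun i j => (d i j : ℝ)) π := by
  simp [permSum]

lemma pairDiff_intCast (d : Fin n → Fin n → ℤ) (e : Fin m × Bool ↪ Fin n) (ρ σ : S n)
    (t : Fin m) : pairDiff (fun i j => (d i j : ℝ)) e ρ σ t = (pairDiff d e ρ σ t : ℤ) :=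
  secDiff_intCast d _ _ _ _

/-! ### Sparsity and conflicts of the integer coefficient matrix. -/

section Sparse

variable {f : S n → ℝ} {c : ℤ} {d : Fin n → Fin n → ℤ} {ε : ℝ}

/-- Nonzero integers have square at least `1`, so the cube bound on the sum of squares leaves at
most `2 + 8 * ε ≤ 3` nonzero second differences per cube on average. -/
lemma sum_ind_secDiff_le (hn : 2 ≤ n) (hf : IsBoolean f)
    (h : 𝔼 π, (f π - (c + permSum d π : ℤ)) ^ 2 ≤ ε) (hε : ε ≤ 1 / 8) :
    ∑ i, ∑ k, ∑ j, ∑ l, ind (secDiff (fun i j => (d i j : ℝ)) i k j l) ≤ 9 * n ^ 3 := by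
  simp only [Int.cast_add, intCast_permSum] at h
  obtain ⟨e⟩ := exists_pairs (n := n) (m := n / 2) (by omega)
  obtain ⟨η, hη, hcube⟩ := exists_cube_defect hf _ c ε h e
  refine (sum_secDiff_le_of_expect_le ind (by simp [ind]) ind_nonneg _ e (by omega) (by omega)
    (β := 3) ?_).trans (by norm_num)
  have hpt : ∀ ρ σ, ∑ t, ind (pairDiff (fun i j => (d i j : ℝ)) e ρ σ t) ≤ 2 + 8 * η ρ σ := by
    intro ρ σ
    refine (sum_le_sum fun t _ => ?_).trans (hcube ρ σ).2.2
    rw [pairDiff_intCast]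
    exact ind_intCast_le_sq _
  refine (expect_le_expect fun ρ _ => expect_le_expect fun σ _ => hpt ρ σ).trans ?_
  simp only [expect_add_distrib, ← mul_expect, Fintype.expect_const]
  linarith

/-- The matrix of second differences at a good base cell is a row and column shift of `d`, so
minimality transfers its sparsity to `d`. -/
lemma MinSupport.suppCard_le (hd : MinSupport d) (hn : 2 ≤ n) (hf : IsBoolean f)
    (h : 𝔼 π, (f π - (c + permSum d π : ℤ)) ^ 2 ≤ ε) (hε : ε ≤ 1 / 8) : suppCard d ≤ 9 * n := by
  obtain ⟨k, l, hkl⟩ := exists_base_le ind _ (by omega) (sum_ind_secDiff_le hn hf h hε)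
  have h1 := hd (fun i => d i l - d k l) fun j => d k j
  have h2 : ((suppCard fun i j => d i j - (d i l - d k l) - d k j : ℕ) : ℝ)
      = ∑ i, ∑ j, ind (secDiff (fun i j => (d i j : ℝ)) i k j l) := by
    rw [suppCard]
    push_cast
    refine sum_congr rfl fun i _ => sum_congr rfl fun j _ => ?_
    rw [secDiff_intCast, ind]
    simp only [Int.cast_eq_zero, ite_not]
    refine if_congr ?_ rfl rfl
    rw [secDiff, show d i j - (d i l - d k l) - d k j = d i j + d k l - d i l - d k j by ring]
  rw [← h2] at hkl
  have h3 : (suppCard fun i j => d i j - (d i l - d k l) - d k j) ≤ 9 * n := by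
    exact_mod_cast hkl
  exact h1.trans h3

/-- Two quadruples on disjoint rows and columns are rarely both nonzero. -/
lemma expect_indPair_le (hn : 1000 ≤ n) (hf : IsBoolean f)
    (h : 𝔼 π, (f π - (c + permSum d π : ℤ)) ^ 2 ≤ ε) (hε : ε ≤ 1 / 8) :
    ∃ p : Bool × Bool → Fin n, p.Injective ∧ (n : ℝ) ^ 2 * 𝔼 ρ : S n, 𝔼 σ : S n,
      indPair (fun i j => (d i j : ℝ)) (fun k => ρ (p k)) (fun k => σ (p k)) ≤ 1500000 * ε := by
  have hQ := sum_ind_secDiff_le (by omega) hf h hε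
  simp only [Int.cast_add, intCast_permSum] at h
  set M : Fin n → Fin n → ℝ := fun i j => (d i j : ℝ) with hM
  -- A third nonzero quadruple costs at most `18 * W / n` for each of at most `m` choices, so `m ≤ n
  -- / 36` preserves half of `W`.
  obtain ⟨m, hm⟩ : ∃ m, m = n / 36 := ⟨_, rfl⟩
  obtain ⟨e⟩ := exists_pairs (n := n) (m := m) (by omega)
  obtain ⟨η, hη, hcube⟩ := exists_cube_defect hf M c ε h e
  let s₀ : Fin m := ⟨0, by omega⟩
  let t₀ : Fin m := ⟨1, by omega⟩
  have hst₀ : s₀ ≠ t₀ := by simp [s₀, t₀]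
  refine ⟨twoPairs e s₀ t₀, twoPairs_injective e hst₀, ?_⟩
  set W := 𝔼 ρ : S n, 𝔼 σ : S n,
    indPair M (fun k => ρ (twoPairs e s₀ t₀ k)) (fun k => σ (twoPairs e s₀ t₀ k)) with hW
  have hW0 : 0 ≤ W := expect_nonneg fun _ _ => expect_nonneg fun _ _ => indPair_nonneg _ _ _
  have hWst : ∀ s t, s ≠ t →
      𝔼 ρ, 𝔼 σ, ind (pairDiff M e ρ σ s) * ind (pairDiff M e ρ σ t) = W := fun s t hst =>
    expect_comp_perm_eq₂ (twoPairs_injective e hst) (twoPairs_injective e hst₀)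
      (twoPairs_injective e hst) (twoPairs_injective e hst₀) (indPair M)
  have hn' : (1000 : ℝ) ≤ n := by exact_mod_cast hn
  have htriple : ∀ s t r, s ≠ t → r ≠ s → r ≠ t → (n : ℝ) * 𝔼 ρ, 𝔼 σ,
      ind (pairDiff M e ρ σ s) * ind (pairDiff M e ρ σ t) * ind (pairDiff M e ρ σ r)
        ≤ 18 * W := by
    intro s t r hst hrs hrt
    have h1 := expect_triple_le M e hst hrs hrt
    rw [hWst s t hst] at h1
    have hX0 : 0 ≤ 𝔼 ρ, 𝔼 σ,
      ind (pairDiff M e ρ σ s) * ind (pairDiff M e ρ σ t) * ind (pairDiff M e ρ σ r) :=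
      expect_nonneg fun _ _ => expect_nonneg fun _ _ =>
        mul_nonneg (mul_nonneg (ind_nonneg _) (ind_nonneg _)) (ind_nonneg _)
    set X := 𝔼 ρ, 𝔼 σ,
      ind (pairDiff M e ρ σ s) * ind (pairDiff M e ρ σ t) * ind (pairDiff M e ρ σ r)
    have h2 : (n : ℝ) ^ 4 / 2 ≤ (((n : ℝ) - 4) * (n - 5)) ^ 2 := by
      have h3 : (3 / 4 : ℝ) * n ^ 2 ≤ ((n : ℝ) - 4) * (n - 5) := by nlinarith
      have h4 : ((3 / 4 : ℝ) * n ^ 2) ^ 2 ≤ (((n : ℝ) - 4) * (n - 5)) ^ 2 :=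
        pow_le_pow_left₀ (by positivity) h3 2
      nlinarith [sq_nonneg ((n : ℝ) ^ 2)]
    have h5 : (n : ℝ) ^ 4 / 2 * X ≤ 9 * n ^ 3 * W :=
      (mul_le_mul_of_nonneg_right h2 hX0).trans
        (h1.trans (mul_le_mul_of_nonneg_right hQ hW0))
    have hn3 : (0 : ℝ) < n ^ 3 / 2 := by positivity
    refine le_of_mul_le_mul_left ?_ hn3
    calc (n : ℝ) ^ 3 / 2 * (n * X) = (n : ℝ) ^ 4 / 2 * X := by ring
      _ ≤ _ := h5
      _ = _ := by ring
  have hm36 : (36 : ℝ) * m ≤ n := by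
    have : 36 * m ≤ n := by omega
    exact_mod_cast this
  have hm72 : (n : ℝ) ≤ 72 * (m - 1) := by
    have : n + 72 ≤ 72 * m := by omega
    have : (n : ℝ) + 72 ≤ 72 * m := by exact_mod_cast this
    linarith
  have hterm : ∀ s, ∀ t ∈ univ.erase s, W / 2 ≤ 𝔼 ρ, 𝔼 σ,
      ind (pairDiff M e ρ σ s) * ind (pairDiff M e ρ σ t)
        * (1 - ∑ r ∈ (univ.erase s).erase t, ind (pairDiff M e ρ σ r)) := by
    intro s t ht
    have hst : s ≠ t := (mem_erase.mp ht).1.symm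
    simp only [mul_sub, mul_one, expect_sub_distrib, mul_sum, expect_sum_comm]
    rw [hWst s t hst]
    have h1 : (n : ℝ) * ∑ r ∈ (univ.erase s).erase t, 𝔼 ρ, 𝔼 σ,
        ind (pairDiff M e ρ σ s) * ind (pairDiff M e ρ σ t) * ind (pairDiff M e ρ σ r)
        ≤ m * (18 * W) := by
      rw [mul_sum]
      refine (sum_le_sum (g := fun _ => 18 * W) fun r hr => ?_).trans ?_
      · exact htriple s t r hst (mem_erase.mp (mem_erase.mp hr).2).1 (mem_erase.mp hr).1
      · rw [sum_const, nsmul_eq_mul]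
        refine mul_le_mul_of_nonneg_right ?_ (by positivity)
        have := card_le_univ ((univ.erase s).erase t)
        rw [Fintype.card_fin] at this
        exact_mod_cast this
    have h2 : (n : ℝ) * ∑ r ∈ (univ.erase s).erase t, 𝔼 ρ, 𝔼 σ,
        ind (pairDiff M e ρ σ s) * ind (pairDiff M e ρ σ t) * ind (pairDiff M e ρ σ r)
        ≤ n * (W / 2) := by
      refine h1.trans ?_
      nlinarith
    have h3 := le_of_mul_le_mul_left h2 (by linarith)
    linarith
  have hbon : ∀ ρ σ, ∑ s, ∑ t ∈ univ.erase s,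
      ind (pairDiff M e ρ σ s) * ind (pairDiff M e ρ σ t)
        * (1 - ∑ r ∈ (univ.erase s).erase t, ind (pairDiff M e ρ σ r)) ≤ 2 * (72 * η ρ σ) := by
    intro ρ σ
    have hη0 : 0 ≤ 72 * η ρ σ := by
      have := (hcube ρ σ).1
      have : 0 ≤ ∑ t, (pairDiff M e ρ σ t - round (pairDiff M e ρ σ t)) ^ 2 :=
        sum_nonneg fun _ _ => sq_nonneg _
      linarith
    refine sum_mul_one_sub_le (fun t => pairDiff M e ρ σ t) hη0 fun s t hst => ?_
    have h1 := (hcube ρ σ).2.1 s t hst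
    have h2 : ∀ r, ind (pairDiff M e ρ σ r) ≤ pairDiff M e ρ σ r ^ 2 := fun r => by
      rw [hM, pairDiff_intCast]
      exact ind_intCast_le_sq _
    have h3 : ∀ z : ℝ, ind z ≤ 1 := fun z => by
      unfold ind
      split_ifs <;> norm_num
    refine le_trans (le_min ?_ ?_) h1
    · exact (mul_le_of_le_one_right (ind_nonneg _) (h3 _)).trans (h2 s)
    · exact (mul_le_of_le_one_left (ind_nonneg _) (h3 _)).trans (h2 t)
  have hmain : (m : ℝ) * (m - 1) * (W / 2) ≤ 144 * ε := by
    have h1 : ∑ s : Fin m, ∑ t ∈ univ.erase s, W / 2 = (m : ℝ) * (m - 1) * (W / 2) := by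
      have : ∀ s : Fin m, ((univ.erase s).card : ℝ) = m - 1 := fun s => by
        rw [card_erase_of_mem (mem_univ s), card_univ, Fintype.card_fin,
          Nat.cast_sub (by omega), Nat.cast_one]
      simp only [sum_const, nsmul_eq_mul, this, card_univ, Fintype.card_fin]
      ring
    rw [← h1]
    refine (sum_le_sum fun s _ => sum_le_sum fun t ht => hterm s t ht).trans ?_
    simp only [← expect_sum_comm]
    refine (expect_le_expect fun ρ _ => expect_le_expect fun σ _ => hbon ρ σ).trans ?_
    simp only [← mul_expect]
    linarith
  have h1 : (n : ℝ) ^ 2 ≤ 5184 * (m * (m - 1)) := by nlinarith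
  have h2 : (n : ℝ) ^ 2 * W ≤ 5184 * (m * (m - 1)) * W := mul_le_mul_of_nonneg_right h1 hW0
  have hε0 : 0 ≤ ε := (expect_nonneg fun _ _ => sq_nonneg _).trans h
  linarith

/-- In minimal form, few pairs of nonzero coefficients lie on distinct rows and columns. -/
theorem MinSupport.conflictFree_le (hd : MinSupport d) (hn : 1000 ≤ n) (hf : IsBoolean f)
    (h : 𝔼 π, (f π - (c + permSum d π : ℤ)) ^ 2 ≤ ε) (hε : ε ≤ 1 / 8) :
    (conflictFree Prod.fst Prod.snd (supp d) : ℝ) ≤ 2 * 10 ^ 8 * ε * n ^ 2 := by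
  obtain ⟨p, hp, hW⟩ := expect_indPair_le hn hf h hε
  have hlow := sum_card_partnerPairs_le d hp
  have hs := hd.suppCard_le (by omega) hf h hε
  -- The support has at most `9 * n` cells, negligible against `n ^ 2` once `n ≥ 1000`.
  have hG : ∀ a ∈ supp d, n ^ 2 ≤ 8 * (partners d a).card := by
    intro a ha
    have := hd.card_partners ha
    nlinarith
  have hP : ∀ a ∈ supp d, ∀ b ∈ (supp d).filter fun b => a.1 ≠ b.1 ∧ a.2 ≠ b.2,
      n ^ 4 ≤ 128 * (partnerPairs d a b).card := by
    intro a ha b hb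
    have h1 := hG a ha
    have h2 := hG b (mem_filter.mp hb).1
    have h3 := card_partners_mul_le d a b
    have h4 : n ^ 2 * n ^ 2 ≤ 8 * (partners d a).card * (8 * (partners d b).card) :=
      Nat.mul_le_mul h1 h2
    have h5 : 1000 * n ^ 3 ≤ n ^ 4 := by
      rw [pow_succ n 3, mul_comm]
      exact Nat.mul_le_mul_left _ hn
    have h6 : n ^ 2 * n ^ 2 = n ^ 4 := by ring
    have h7 : 8 * (partners d a).card * (8 * (partners d b).card)
        = 64 * ((partners d a).card * (partners d b).card) := by ring
    omega
  have hcount : n ^ 4 * conflictFree Prod.fst Prod.snd (supp d)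
      ≤ 128 * ∑ a ∈ supp d, ∑ b ∈ (supp d).filter fun b => a.1 ≠ b.1 ∧ a.2 ≠ b.2,
        (partnerPairs d a b).card := by
    rw [conflictFree, mul_sum, mul_sum]
    refine sum_le_sum fun a ha => ?_
    rw [mul_comm, ← smul_eq_mul, ← sum_const, mul_sum]
    exact sum_le_sum fun b hb => hP a ha b hb
  have hcount' : (n : ℝ) ^ 4 * conflictFree Prod.fst Prod.snd (supp d)
      ≤ 128 * ((∑ a ∈ supp d, ∑ b ∈ (supp d).filter fun b => a.1 ≠ b.1 ∧ a.2 ≠ b.2,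
        (partnerPairs d a b).card : ℕ) : ℝ) := by exact_mod_cast hcount
  have hn0 : (0 : ℝ) < n := by
    have : 0 < n := by omega
    exact_mod_cast this
  have hε0 : 0 ≤ ε := (expect_nonneg fun _ _ => sq_nonneg _).trans h
  set W := 𝔼 ρ : S n, 𝔼 σ : S n,
    indPair (fun i j => (d i j : ℝ)) (fun k => ρ (p k)) (fun k => σ (p k))
  have hn6 : (0 : ℝ) < n ^ 6 := by positivity
  have h8 : (n : ℝ) ^ 8 * W ≤ n ^ 6 * (1500000 * ε) := by
    calc (n : ℝ) ^ 8 * W = n ^ 6 * (n ^ 2 * W) := by ring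
      _ ≤ _ := mul_le_mul_of_nonneg_left hW hn6.le
  refine le_of_mul_le_mul_left (a := (n : ℝ) ^ 4) ?_ (by positivity)
  calc _ ≤ 128 * ((n : ℝ) ^ 6 * (1500000 * ε)) := by linarith
    _ ≤ (n : ℝ) ^ 4 * (2 * 10 ^ 8 * ε * n ^ 2) := by
      have : 0 ≤ (n : ℝ) ^ 6 * ε := by positivity
      nlinarith

lemma exists_minSupport_permSum (c : ℤ) (d : Fin n → Fin n → ℤ) :
    ∃ (c' : ℤ) (d' : Fin n → Fin n → ℤ), MinSupport d' ∧
      ∀ π, c + permSum d π = c' + permSum d' π := by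
  obtain ⟨u, v, huv⟩ := exists_minSupport d
  refine ⟨c + ∑ i, u i + ∑ j, v j, _, huv, fun π => ?_⟩
  rw [permSum_sub_potential]
  ring

end Sparse

end NearlyLinear

/-! ### From concentration on a line to a dictator. -/

namespace NearlyLinear

variable {n : ℕ}

lemma expectation_eq_expect (f : S n → ℝ) : expectation f = 𝔼 π, f π := by
  rw [expectation, Fintype.expect_eq_sum_div_card]

lemma prob_le_expect {P : S n → Prop} {ψ : S n → ℝ} (h0 : ∀ π, 0 ≤ ψ π)
    (h1 : ∀ π, P π → 1 ≤ ψ π) : prob P ≤ 𝔼 π, ψ π := by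
  classical
  rw [prob, Fintype.expect_eq_sum_div_card]
  refine div_le_div_of_nonneg_right ?_ (Nat.cast_nonneg _)
  rw [card_filter]
  push_cast
  refine sum_le_sum fun π _ => ?_
  split_ifs with h
  exacts [h1 π h, h0 π]

lemma card_mul_expect_hits (E : Finset (Fin n × Fin n)) :
    (n : ℝ) * 𝔼 π : S n, ∑ a ∈ E, x a.1 a.2 π = E.card := by
  rw [expect_sum_comm, mul_sum, card_eq_sum_ones]
  push_cast
  refine sum_congr rfl fun a _ => ?_
  simp only [x]
  rw [card_mul_expect_apply a.1 fun j => if j = a.2 then (1 : ℝ) else 0]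
  simp

lemma x_nonneg (i j : Fin n) (π : S n) : 0 ≤ x i j π := by
  unfold x
  split_ifs <;> norm_num

lemma one_le_hits {E : Finset (Fin n × Fin n)} {π : S n} {a : Fin n × Fin n} (ha : a ∈ E)
    (h : π a.1 = a.2) : 1 ≤ ∑ a ∈ E, x a.1 a.2 π := by
  refine le_trans (le_of_eq ?_) (single_le_sum (f := fun a => x a.1 a.2 π)
    (fun a _ => x_nonneg _ _ _) ha)
  simp [x, h]

lemma one_le_sq_sub {f : S n → ℝ} (hf : IsBoolean f) {π : S n} {z : ℤ} (h : f π ≠ z) :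
    1 ≤ (f π - z) ^ 2 := by
  have key : ∀ w : ℤ, w ≠ 0 → (1 : ℝ) ≤ (w : ℝ) ^ 2 := by
    intro w hw
    have : (1 : ℤ) ≤ w ^ 2 := by nlinarith [Int.one_le_abs hw, sq_abs w]
    exact_mod_cast this
  rcases hf π with h0 | h0
  · have := key (0 - z) (fun hz => h (by rw [h0, ← sub_eq_zero]; exact_mod_cast hz))
    rw [h0]
    exact_mod_cast this
  · have := key (1 - z) (fun hz => h (by rw [h0, ← sub_eq_zero]; exact_mod_cast hz))
    rw [h0]
    exact_mod_cast this

section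

variable {f : S n → ℝ} {c : ℤ} {d : Fin n → Fin n → ℤ} {ε : ℝ}

/-- Union bound: a disagreement means either that `f` differs from the integer linear function,
adding at least `1` to the squared error, or that `π` hits a cell of `E`. -/
lemma prob_ne_le (hn : 0 < n) (hf : IsBoolean f)
    (h : 𝔼 π, (f π - (c + permSum d π : ℤ)) ^ 2 ≤ ε) (g : S n → ℝ) (E : Finset (Fin n × Fin n))
    (hg : ∀ π, (∀ a ∈ E, π a.1 ≠ a.2) → f π = (c + permSum d π : ℤ) → f π = g π) :
    prob (fun π => f π ≠ g π) ≤ ε + E.card / n := by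
  have hn' : (0 : ℝ) < n := by exact_mod_cast hn
  have hE : 𝔼 π : S n, ∑ a ∈ E, x a.1 a.2 π = E.card / n := by
    rw [eq_div_iff hn'.ne', mul_comm]
    exact card_mul_expect_hits E
  have hnn : ∀ π : S n, 0 ≤ ∑ a ∈ E, x a.1 a.2 π := fun π =>
    sum_nonneg fun a _ => x_nonneg _ _ _
  refine (prob_le_expect (ψ := fun π => (f π - (c + permSum d π : ℤ)) ^ 2
    + ∑ a ∈ E, x a.1 a.2 π) (fun π => add_nonneg (sq_nonneg _) (hnn π)) fun π hπ => ?_).trans ?_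
  · by_cases h1 : f π = (c + permSum d π : ℤ)
    · have : ∃ a ∈ E, π a.1 = a.2 := by
        by_contra! hcon
        exact hπ (hg π hcon h1)
      obtain ⟨a, ha, haπ⟩ := this
      exact (one_le_hits ha haπ).trans (le_add_of_nonneg_left (sq_nonneg _))
    · exact (one_le_sq_sub hf h1).trans (le_add_of_nonneg_right (hnn π))
  · rw [expect_add_distrib, hE]
    linarith

/-- A function with mean away from `0` and `1` is close only to functions with many nonzero
coefficients. -/
lemma le_add_card_supp_div (hn : 0 < n) (hf : IsBoolean f)
    (h : 𝔼 π, (f π - (c + permSum d π : ℤ)) ^ 2 ≤ ε) {δ : ℝ} (h1 : δ ≤ 𝔼 π, f π)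
    (h2 : 𝔼 π, f π ≤ 1 - δ) : δ ≤ ε + (supp d).card / n := by
  have h3 := prob_ne_le hn hf h (fun _ => (c : ℝ)) (supp d) fun π hπ hfπ => by
    have : permSum d π = 0 := by
      refine sum_eq_zero fun i _ => ?_
      by_contra hne
      exact hπ (i, π i) (mem_filter.mpr ⟨mem_univ _, hne⟩) rfl
    rw [hfπ, this, add_zero]
  refine le_trans ?_ h3
  classical
  rw [prob, card_filter]
  push_cast
  rw [← Fintype.expect_eq_sum_div_card]
  by_cases h0 : c = 0
  · refine h1.trans (expect_le_expect fun π _ => ?_)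
    rcases hf π with h4 | h4 <;> simp [h4, h0]
  · have h5 : δ ≤ 𝔼 π, (1 - f π) := by
      rw [expect_sub_distrib, Fintype.expect_const]
      linarith
    refine h5.trans (expect_le_expect fun π _ => ?_)
    have hc : (0 : ℝ) ≠ c := by exact_mod_cast (Ne.symm h0)
    rcases hf π with h4 | h4 <;> rw [h4]
    · rw [if_pos hc, sub_zero]
    · split_ifs <;> norm_num

/-- Round a real number to a truth value. -/
noncomputable def toBit (u : ℝ) : ℝ := if u = 1 then 1 else 0

lemma toBit_eq_zero_or_one (u : ℝ) : toBit u = 0 ∨ toBit u = 1 := by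
  unfold toBit
  split_ifs
  exacts [Or.inr rfl, Or.inl rfl]

lemma toBit_of_isBoolean (hf : IsBoolean f) (π : S n) : toBit (f π) = f π := by
  rcases hf π with h | h <;> simp [toBit, h]

/-- The theorem for large `n`, for a function close to a linear function with integer
coefficients. -/
theorem exists_dictator_of_large (hn : 1000 ≤ n) (hf : IsBoolean f)
    (h : 𝔼 π, (f π - (c + permSum d π : ℤ)) ^ 2 ≤ ε) (hε : ε ≤ 1 / 8) {δ : ℝ} (hδ : 0 < δ)
    (h1 : δ ≤ 𝔼 π, f π) (h2 : 𝔼 π, f π ≤ 1 - δ) (hεδ : 2 * ε ≤ δ)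
    (hεδ₂ : 8 * 10 ^ 9 * ε ≤ δ ^ 2) :
    ∃ g : S n → ℝ, IsDictator g ∧
      prob (fun π => f π ≠ g π) ≤ ε + 16 * 10 ^ 8 * (ε / δ) := by
  obtain ⟨c', d', hd, hcd⟩ := exists_minSupport_permSum c d
  simp only [hcd] at h
  clear hcd
  have hn0 : 0 < n := by omega
  have hn' : (0 : ℝ) < n := by exact_mod_cast hn0
  have hNC := hd.conflictFree_le hn hf h hε
  have hcard : δ * n ≤ 2 * (supp d').card := by
    have h3 := le_add_card_supp_div hn0 hf h h1 h2
    have h4 : δ / 2 ≤ (supp d').card / n := by linarith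
    rw [le_div_iff₀ hn'] at h4
    linarith
  have hε0 : 0 ≤ ε := (expect_nonneg fun _ _ => sq_nonneg _).trans h
  have hpos : (0 : ℝ) < (supp d').card := by nlinarith [mul_pos hδ hn']
  have hne : (supp d').Nonempty := card_pos.mp (by exact_mod_cast hpos)
  -- Ten times the conflict-free count is at most `2 * 10 ^ 9 * ε * n ^ 2 ≤ (δ * n / 2) ^ 2`.
  have hNC10 : 10 * conflictFree Prod.fst Prod.snd (supp d') ≤ (supp d').card ^ 2 := by
    have h3 : (δ * n) ^ 2 ≤ (2 * ((supp d').card : ℝ)) ^ 2 :=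
      pow_le_pow_left₀ (by positivity) hcard 2
    have h4 : 8 * 10 ^ 9 * ε * (n : ℝ) ^ 2 ≤ δ ^ 2 * n ^ 2 :=
      mul_le_mul_of_nonneg_right hεδ₂ (by positivity)
    have h5 : (10 * conflictFree Prod.fst Prod.snd (supp d') : ℝ) ≤ (supp d').card ^ 2 := by
      nlinarith
    exact_mod_cast h5
  have hoff : ∀ E : Finset (Fin n × Fin n),
      (supp d').card * E.card ≤ 4 * conflictFree Prod.fst Prod.snd (supp d') →
      ε + (E.card : ℝ) / n ≤ ε + 16 * 10 ^ 8 * (ε / δ) := by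
    intro E hE
    have hE' : ((supp d').card : ℝ) * E.card
        ≤ 4 * conflictFree Prod.fst Prod.snd (supp d') := by exact_mod_cast hE
    have h3 : δ * n * E.card ≤ 2 * (supp d').card * E.card :=
      mul_le_mul_of_nonneg_right hcard (Nat.cast_nonneg _)
    have h4 : n * (δ * E.card) ≤ (n : ℝ) * (16 * 10 ^ 8 * ε * n) := by nlinarith
    have h5 := le_of_mul_le_mul_left h4 hn'
    have h6 : (E.card : ℝ) / n ≤ 16 * 10 ^ 8 * (ε / δ) := by
      rw [div_le_iff₀ hn', ← mul_div_assoc, div_mul_eq_mul_div, le_div_iff₀ hδ]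
      linarith
    linarith
  rcases exists_line_of_conflictFree_le Prod.fst Prod.snd (fun a b => Prod.ext) hne hNC10
    with ⟨i, hi⟩ | ⟨j, hj⟩
  · refine ⟨fun π => toBit (c' + d' i (π i) : ℤ), ⟨fun π => toBit_eq_zero_or_one _,
      Or.inl ⟨i, fun j => toBit (c' + d' i j : ℤ), fun π => rfl⟩⟩, ?_⟩
    refine (prob_ne_le hn0 hf h _ _ fun π hπ hfπ => ?_).trans (hoff _ hi)
    have h3 : permSum d' π = d' i (π i) := by
      refine sum_eq_single i (fun k _ hk => ?_) (by simp)
      by_contra hne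
      exact hπ (k, π k) (mem_filter.mpr ⟨mem_filter.mpr ⟨mem_univ _, hne⟩, hk⟩) rfl
    rw [← h3, ← hfπ, toBit_of_isBoolean hf]
  · refine ⟨fun π => toBit (c' + d' (π⁻¹ j) j : ℤ), ⟨fun π => toBit_eq_zero_or_one _,
      Or.inr ⟨j, fun i => toBit (c' + d' i j : ℤ), fun π => rfl⟩⟩, ?_⟩
    refine (prob_ne_le hn0 hf h _ _ fun π hπ hfπ => ?_).trans (hoff _ hj)
    have h3 : permSum d' π = d' (π⁻¹ j) j := by
      rw [permSum, sum_eq_single (π⁻¹ j) (fun k _ hk => ?_) (by simp)]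
      · simp
      by_contra hne
      refine hπ (k, π k) (mem_filter.mpr ⟨mem_filter.mpr ⟨mem_univ _, hne⟩, fun he => hk ?_⟩) rfl
      rw [← he]
      simp
    rw [← h3, ← hfπ, toBit_of_isBoolean hf]

/-- For small `n`, a function very close to integer linear is integer linear. -/
theorem isDictator_of_small (hn : 0 < n) (hf : IsBoolean f)
    (h : 𝔼 π, (f π - (c + permSum d π : ℤ)) ^ 2 ≤ ε) (hε : ε * n.factorial < 1) :
    IsDictator f := by
  refine isDictator_of_eq_permSum hn hf c d fun π => ?_
  by_contra hne
  have h1 := one_le_sq_sub hf hne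
  rw [Fintype.expect_eq_sum_div_card, Fintype.card_perm, Fintype.card_fin,
    div_le_iff₀ (by exact_mod_cast n.factorial_pos)] at h
  have h2 := single_le_sum (f := fun π => (f π - (c + permSum d π : ℤ)) ^ 2)
    (fun π _ => sq_nonneg _) (mem_univ π)
  linarith

end

lemma exists_permSum_of_isLinear {g : S n → ℝ} (h : IsLinear g) :
    ∃ M : Fin n → Fin n → ℝ, ∀ π, g π = permSum M π := by
  obtain ⟨M, hM⟩ := h
  refine ⟨M, fun π => ?_⟩
  rw [hM, permSum]
  simp [x]

end NearlyLinear

theorem theorem6 :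
    ∃ K : ℝ, 0 < K ∧ ∃ C : ℝ, 0 < C ∧
      ∀ (n : ℕ) (f : NearlyLinear.S n → ℝ) (ε δ : ℝ),
        NearlyLinear.IsBoolean f →
        NearlyLinear.CloseToLinear ε f →
        0 < δ →
        K * Real.sqrt ε ≤ δ →
        δ ≤ NearlyLinear.expectation f →
        NearlyLinear.expectation f ≤ 1 - δ →
        ∃ g : NearlyLinear.S n → ℝ, NearlyLinear.IsDictator g ∧
          NearlyLinear.prob (fun π => f π ≠ g π) ≤ C * (ε / δ) := by
  obtain ⟨L, hL⟩ : ∃ L : ℕ, ∀ n < 1000, n.factorial ≤ L := by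
    obtain ⟨L, hL⟩ := ((Set.finite_Iio 1000).image Nat.factorial).bddAbove
    exact ⟨L, fun n hn => hL (Set.mem_image_of_mem _ hn)⟩
  have hL1 : (1 : ℝ) ≤ L := by exact_mod_cast hL 0 (by norm_num)
  -- Squaring `K` gives `10 ^ 14 * L ^ 2`, which exceeds `8 * 10 ^ 9 * 10760` as needed for large
  -- `n` and absorbs `n !` for small `n`; `C` covers `10760 * (1 + 16 * 10 ^ 8)`.
  refine ⟨10 ^ 7 * L, by positivity, 10 ^ 14, by positivity, ?_⟩
  intro n f ε δ hf hlin hδ hK h1 h2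
  obtain ⟨g, hg, hfg⟩ := hlin
  obtain ⟨M, hM⟩ := NearlyLinear.exists_permSum_of_isLinear hg
  rw [NearlyLinear.expectation_eq_expect] at h1 h2 hfg
  simp only [hM] at hfg
  have hε0 : 0 ≤ ε := (expect_nonneg fun _ _ => sq_nonneg _).trans hfg
  have hKε : (10 ^ 7 * (L : ℝ)) ^ 2 * ε ≤ δ ^ 2 := by
    have := pow_le_pow_left₀ (by positivity) hK 2
    rwa [mul_pow, Real.sq_sqrt hε0] at this
  have hLε : 10 ^ 14 * (L * ε) ≤ δ ^ 2 := by
    refine le_trans ?_ hKε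
    have : (L : ℝ) * ε ≤ L * (L * ε) := le_mul_of_one_le_left (by positivity) hL1
    linarith
  have hε' : 10 ^ 14 * ε ≤ δ ^ 2 :=
    le_trans (mul_le_mul_of_nonneg_left (le_mul_of_one_le_left hε0 hL1) (by positivity)) hLε
  have hδ2 : δ ≤ 1 / 2 := by linarith
  -- For `n ≤ 1` there is a single permutation, so the mean is `0` or `1`, which `δ > 0` excludes.
  -- This also disposes of `n = 0`, where no dictator exists.
  rcases Nat.lt_or_ge n 2 with hn | hn
  · exfalso
    have : Subsingleton (Fin n) := by
      interval_cases n
      · exact inferInstanceAs (Subsingleton (Fin 0))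
      · exact inferInstanceAs (Subsingleton (Fin 1))
    have hconst : 𝔼 π, f π = f 1 := by
      rw [← Fintype.expect_const (f 1) (ι := NearlyLinear.S n)]
      exact expect_congr rfl fun π _ => by rw [Subsingleton.elim π 1]
    rcases hf 1 with h0 | h0 <;> rw [hconst, h0] at h1 h2 <;> linarith
  obtain ⟨c, d, hcd⟩ := NearlyLinear.exists_int_permSum hn hf M hfg
  have hεδ : 0 ≤ ε / δ := by positivity
  rcases Nat.lt_or_ge n 1000 with hn' | hn'
  · refine ⟨f, NearlyLinear.isDictator_of_small (by omega) hf hcd ?_, ?_⟩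
    · have h3 : (n.factorial : ℝ) ≤ L := by exact_mod_cast hL n hn'
      have h4 : ε * n.factorial ≤ L * ε := by
        rw [mul_comm]
        exact mul_le_mul_of_nonneg_right h3 hε0
      nlinarith
    · simp only [NearlyLinear.prob, ne_eq, not_true_eq_false, filter_false, card_empty,
        Nat.cast_zero, zero_div]
      positivity
  · obtain ⟨g, hg, hprob⟩ := NearlyLinear.exists_dictator_of_large hn' hf hcd (by nlinarith) hδ h1 h2
      (by nlinarith) (by nlinarith)
    refine ⟨g, hg, hprob.trans ?_⟩
    have h3 : ε ≤ ε / δ := by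
      rw [le_div_iff₀ hδ]
      exact mul_le_of_le_one_right hε0 (by linarith)
    rw [mul_div_assoc]
    linarith
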